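/- **Conventions.** Supermanifolds are smooth, with Hausdorff second countable reduced space, and are described by local coordinates $x^a$ (even and odd, of parity $\tilde a$). A *Q-manifold* $(M,Q)$ is a supermanifold $M$ with an odd vector field $Q=Q^a\,\partial/\partial x^a$ such that $Q^2=0$, i.e. $Q^a\,\partial Q^b/\partial x^a=0$. Its *standard cohomology* is $H_{\rm St}(M,Q)=\{f\in C^\infty(M): Qf=0\}/\{Qg: g\in C^\infty(M)\}$. A *Berezin volume* is a nowhere vanishing (i.e. with invertible local density) even section $\boldsymbol\rho=D[x]\,\rho(x)$ of the Berezin bundle, where $D[x']=D[x]\,\mathrm{Ber}(\partial x'/\partial x)$ under changes of coordinates. The *divergence* of $Q$ is the function defined by $\boldsymbol\rho\,\mathrm{Div}_{\boldsymbol\rho}Q=L_Q\boldsymbol\rho$, in coordinates $\mathrm{Div}_{\boldsymbol\rho}Q=\frac1\rho\frac{\partial}{\partial x^a}(Q^a\rho)$ (left derivatives). A *modular class* $\mathrm{Mod}(Q)$ of $(M,Q)$ is a class $[\mathrm{Div}_{\boldsymbol\rho}Q]\in H_{\rm St}(M,Q)$, for some Berezin volume $\boldsymbol\rho$ on $M$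 (one exists, for instance, whenever $M$ is superoriented). **Proposition.** Let $(M_1,Q_1)$ and $(M_2,Q_2)$ be Q-manifolds that have modular classes $\mathrm{Mod}(Q_1)$ and $\mathrm{Mod}(Q_2)$. Let $(M_{12},Q_{12})=(M_1\times M_2,\,Q_1+Q_2)$ be their Q-manifold product, and let $p_k^*:H_{\rm St}(M_k,Q_k)\to H_{\rm St}(M_{12},Q_{12})$ be the maps induced by the projections $p_k:M_1\times M_2\to M_k$ ($k=1,2$). Then the Q-manifold product has exactly one modular class (so that it does not depend on the Berezin volume on $M_{12}$), and $$\mathrm{Mod}(Q_{12})=p_1^*\,\mathrm{Mod}(Q_1)+p_2^*\,\mathrm{Mod}(Q_2).$$ -/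

import Mathlib

open scoped ContDiff

noncomputable section

namespace Super

/-! ### Grassmann algebras -/

/-- The real Grassmann algebra with generators indexed by `κ`. -/
abbrev Grassmann (κ : Type) : Type := ExteriorAlgebra ℝ (κ → ℝ)

/-- The subspace of elements of Grassmann parity `p`. -/
abbrev parityPart (κ : Type) (p : ZMod 2) : Submodule ℝ (Grassmann κ) :=
  CliffordAlgebra.evenOdd (0 : QuadraticForm ℝ (κ → ℝ)) p

/-- The subalgebra of even elements. -/
abbrev evenPart (κ : Type) : Subalgebra ℝ (Grassmann κ) :=
  CliffordAlgebra.even (0 : QuadraticForm ℝ (κ → ℝ))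

theorem mul_eq_of_mem {κ : Type} {p q : ZMod 2} {x y : Grassmann κ}
    (hx : x ∈ parityPart κ p) (hy : y ∈ parityPart κ q) :
    x * y = (-1 : ℤˣ) ^ (q * p) • (y * x) := by
  have h := CliffordAlgebra.map_mul_map_of_isOrtho_of_mem_evenOdd
    (QuadraticMap.Isometry.id (0 : QuadraticForm ℝ (κ → ℝ)))
    (QuadraticMap.Isometry.id (0 : QuadraticForm ℝ (κ → ℝ)))
    (fun a b => by simp [QuadraticMap.isOrtho_def]) x y hx hy
  simpa [CliffordAlgebra.map_id] using h

/-- The even elements form a commutative ring. -/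
instance evenPart.instCommRing (κ : Type) : CommRing (evenPart κ) :=
  { (inferInstance : Ring (evenPart κ)) with
    mul_comm := fun x y => Subtype.ext (by
      have h := mul_eq_of_mem (p := 0) (q := 0) x.2 y.2
      simpa using h) }

theorem odd_mul_self {κ : Type} {x : Grassmann κ} (hx : x ∈ parityPart κ 1) : x * x = 0 := by
  have h := mul_eq_of_mem hx hx
  have h2 : x * x = -(x * x) := by simpa using h
  have h3 : (2 : ℝ) • (x * x) = 0 := by
    rw [two_smul]
    nth_rewrite 1 [h2]
    exact neg_add_cancel _
  exact (smul_eq_zero.mp h3).resolve_left two_ne_zero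

instance Grassmann.instFinite (κ : Type) [Finite κ] : Module.Finite ℝ (Grassmann κ) := by
  let := Fintype.ofFinite κ
  let : LinearOrder κ := LinearOrder.lift' _ (Fintype.equivFin κ).injective
  exact Module.Finite.of_basis (Pi.basisFun ℝ κ).ExteriorAlgebra

/-- A norm on the (finite-dimensional) Grassmann algebra; all choices are equivalent, and the norm
is only used to make sense of smoothness and of partial derivatives. -/
instance Grassmann.instNormedAddCommGroup (κ : Type) [Finite κ] :
    NormedAddCommGroup (Grassmann κ) :=
  NormedAddCommGroup.induced (Grassmann κ) _
    (Module.finBasis ℝ (Grassmann κ)).equivFun.toLinearMap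
    (Module.finBasis ℝ (Grassmann κ)).equivFun.injective

instance Grassmann.instNormedSpace (κ : Type) [Finite κ] : NormedSpace ℝ (Grassmann κ) :=
  NormedSpace.induced ℝ (Grassmann κ) _ (Module.finBasis ℝ (Grassmann κ)).equivFun.toLinearMap

/-- The body of a Grassmann number: its component in degree zero. -/
def body {κ : Type} : Grassmann κ →ₐ[ℝ] ℝ := ExteriorAlgebra.algebraMapInv

/-- The generator `θ k`. -/
def theta {κ : Type} [DecidableEq κ] (k : κ) : Grassmann κ :=
  ExteriorAlgebra.ι ℝ (Pi.single k 1)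

theorem theta_mem {κ : Type} [DecidableEq κ] (k : κ) : theta k ∈ parityPart κ 1 :=
  CliffordAlgebra.ι_mem_evenOdd_one _ _

/-- The nilpotent part of an even Grassmann number. -/
def soul {κ : Type} (y : evenPart κ) : evenPart κ := y - algebraMap ℝ (evenPart κ) (body y.1)

/-- The projection onto the even part. -/
def toEven {κ : Type} (x : Grassmann κ) : evenPart κ :=
  DirectSum.decompose (CliffordAlgebra.evenOdd (0 : QuadraticForm ℝ (κ → ℝ))) x 0

/-- The parity of the coordinate with a given index. -/
def coordParity {ι κ : Type} : ι ⊕ κ → ZMod 2 := Sum.elim (fun _ => 0) (fun _ => 1)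

/-! ### Superdomains -/

/-- Values for the coordinates of `ℝ^{ι|κ}` in the Grassmann algebra on `μ`: an even element for
every even coordinate and an odd element for every odd coordinate. -/
structure Point (ι κ μ : Type) where
  even : ι → evenPart μ
  odd : κ → parityPart μ 1

namespace Point

/-- All the coordinates together. -/
def coord {ι κ μ : Type} (z : Point ι κ μ) : ι ⊕ κ → Grassmann μ :=
  Sum.elim (fun a => (z.even a : Grassmann μ)) (fun k => (z.odd k : Grassmann μ))

/-- The underlying point of `ℝ^ι`. -/
def base {ι κ μ : Type} (z : Point ι κ μ) : ι → ℝ := fun a => body (z.even a : Grassmann μ)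

/-- The substitution `θ k ↦ z.odd k`, as an algebra morphism. -/
def oddSubst {ι κ μ : Type} [Fintype κ] (z : Point ι κ μ) : Grassmann κ →ₐ[ℝ] Grassmann μ :=
  ExteriorAlgebra.lift ℝ
    ⟨Fintype.linearCombination ℝ (fun k => (z.odd k : Grassmann μ)), fun v => odd_mul_self (by
      rw [Fintype.linearCombination_apply]
      exact Submodule.sum_mem _ fun k _ => Submodule.smul_mem _ _ (z.odd k).2)⟩

/-- The coordinates `(x, θ)` of `ℝ^{ι|κ}` at the point `x`. -/
def self {ι κ : Type} [DecidableEq κ] (x : ι → ℝ) : Point ι κ κ where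
  even := fun a => algebraMap ℝ (evenPart κ) (x a)
  odd := fun k => ⟨theta k, theta_mem k⟩

end Point

/-- Substitution of `z` into the superfunction `f(x, θ)`: the even coordinates are substituted by
the Taylor expansion around the base of `z` (which stops, as the souls are nilpotent). -/
def subst {ι κ μ : Type} [Fintype ι] [DecidableEq ι] [Fintype κ] [Fintype μ]
    (f : (ι → ℝ) → Grassmann κ) (z : Point ι κ μ) : Grassmann μ :=
  ∑ n ∈ Finset.range (Fintype.card μ + 1), ((n.factorial : ℝ)⁻¹) •
    ∑ a : Fin n → ι,
      z.oddSubst (iteratedFDeriv ℝ n f z.base (fun l => Pi.single (a l) 1)) *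
        ((∏ l, soul (z.even (a l)) : evenPart μ) : Grassmann μ)

/-- The (left) partial derivatives of a superfunction with respect to the even and odd
coordinates. -/
def partialD {ι κ : Type} [Fintype ι] [DecidableEq ι] [Fintype κ] (a : ι ⊕ κ) (f : (ι → ℝ) → Grassmann κ) (x : ι → ℝ) : Grassmann κ :=
  Sum.elim (fun b => fderiv ℝ f x (Pi.single b 1))
    (fun k => CliffordAlgebra.contractLeft (LinearMap.proj k : Module.Dual ℝ (κ → ℝ)) (f x)) a

/-- The Berezinian `det (A - B D⁻¹ C) (det D)⁻¹` of an even supermatrix with blocks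
`A, B, C, D`. -/
def berezinian {ι κ μ : Type} [Fintype ι] [DecidableEq ι] [Fintype κ] [DecidableEq κ]
    (J : Matrix (ι ⊕ κ) (ι ⊕ κ) (Grassmann μ)) : Grassmann μ :=
  let A : Matrix ι ι (evenPart μ) := J.toBlocks₁₁.map toEven
  let D : Matrix κ κ (evenPart μ) := J.toBlocks₂₂.map toEven
  let D' : Matrix κ κ (Grassmann μ) := D⁻¹.map Subtype.val
  (((A - (J.toBlocks₁₂ * D' * J.toBlocks₂₁).map toEven).det * Ring.inverse D.det : evenPart μ) :
    Grassmann μ)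

/-! ### Nilpotency -/

/-- The elements of degree at least `n`. -/
def degGE (κ : Type) (n : ℕ) : Submodule ℝ (Grassmann κ) :=
  ⨆ j : {j : ℕ // n ≤ j}, LinearMap.range (ExteriorAlgebra.ι ℝ (M := κ → ℝ)) ^ (j : ℕ)

theorem degGE_mul (κ : Type) (m n : ℕ) : degGE κ m * degGE κ n ≤ degGE κ (m + n) := by
  rw [degGE, degGE, Submodule.iSup_mul]
  refine iSup_le fun i => ?_
  rw [Submodule.mul_iSup]
  refine iSup_le fun j => ?_
  rw [← pow_add]
  exact le_iSup (fun j : {j : ℕ // m + n ≤ j} =>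
    LinearMap.range (ExteriorAlgebra.ι ℝ (M := κ → ℝ)) ^ (j : ℕ))
    ⟨i.1 + j.1, add_le_add i.2 j.2⟩

theorem degGE_eq_bot (κ : Type) [Fintype κ] (n : ℕ) (hn : Fintype.card κ < n) :
    degGE κ n = ⊥ := by
  refine iSup_eq_bot.mpr fun j => ?_
  have h : Module.finrank ℝ (⋀[ℝ]^(j : ℕ) (κ → ℝ)) = 0 := by
    rw [exteriorPower.finrank_eq, Module.finrank_fintype_fun_eq_card]
    exact Nat.choose_eq_zero_of_lt (hn.trans_le j.2)
  exact Submodule.finrank_eq_zero.mp h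

theorem body_of_mem_degGE_one {κ : Type} {x : Grassmann κ} (hx : x ∈ degGE κ 1) : body x = 0 := by
  have h : degGE κ 1 ≤ LinearMap.ker (body (κ := κ)).toLinearMap := by
    refine iSup_le fun j => ?_
    obtain ⟨j, hj⟩ := j
    obtain ⟨j, rfl⟩ := Nat.exists_eq_succ_of_ne_zero (Nat.one_le_iff_ne_zero.mp hj)
    change _ ^ (j + 1) ≤ _
    rw [pow_succ, Submodule.mul_le]
    rintro a - _ ⟨v, rfl⟩
    simp [body, ExteriorAlgebra.algebraMapInv]
  exact h hx

theorem mem_degGE_one {κ : Type} {x : Grassmann κ} (hx : body x = 0) : x ∈ degGE κ 1 := by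
  have h : x ∈ LinearMap.range (Algebra.linearMap ℝ (Grassmann κ)) ⊔ degGE κ 1 := by
    have h1 : (⊤ : Submodule ℝ (Grassmann κ)) ≤
        LinearMap.range (Algebra.linearMap ℝ (Grassmann κ)) ⊔ degGE κ 1 := by
      rw [← CliffordAlgebra.iSup_ι_range_eq_top]
      refine iSup_le fun j => ?_
      rcases Nat.eq_zero_or_pos j with rfl | hj
      · rw [pow_zero, Submodule.one_eq_range]
        exact le_sup_left
      · exact le_sup_of_le_right (le_iSup (fun j : {j : ℕ // 1 ≤ j} =>
          LinearMap.range (ExteriorAlgebra.ι ℝ (M := κ → ℝ)) ^ (j : ℕ)) ⟨j, hj⟩)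
    exact h1 trivial
  obtain ⟨_, ⟨r, rfl⟩, y, hy, rfl⟩ := Submodule.mem_sup.mp h
  have h2 := body_of_mem_degGE_one hy
  have h3 : r = 0 := by
    rw [map_add, h2, add_zero] at hx
    simpa [body] using hx
  simpa [h3] using hy

theorem body_soul {κ : Type} (y : evenPart κ) : body (soul y : Grassmann κ) = 0 := by
  have : ((algebraMap ℝ (evenPart κ) (body y.1) : evenPart κ) : Grassmann κ)
      = algebraMap ℝ (Grassmann κ) (body y.1) := rfl
  rw [soul, AddSubgroupClass.coe_sub, map_sub, this, AlgHom.commutes]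
  simp

theorem prod_soul_mem {κ : Type} {n : ℕ} (y : Fin n → evenPart κ) :
    ((∏ l, soul (y l) : evenPart κ) : Grassmann κ) ∈ degGE κ n := by
  induction n with
  | zero =>
    have h : (1 : Submodule ℝ (Grassmann κ)) ≤ degGE κ 0 := by
      rw [← pow_zero (LinearMap.range (ExteriorAlgebra.ι ℝ (M := κ → ℝ)))]
      exact le_iSup (fun j : {j : ℕ // 0 ≤ j} =>
        LinearMap.range (ExteriorAlgebra.ι ℝ (M := κ → ℝ)) ^ (j : ℕ)) ⟨0, le_rfl⟩
    simpa using h (Submodule.one_le.mp le_rfl)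
  | succ n ih =>
    rw [Fin.prod_univ_succ, MulMemClass.coe_mul]
    have h := degGE_mul κ 1 n
      (Submodule.mul_mem_mul (mem_degGE_one (body_soul (y 0))) (ih fun l => y l.succ))
    rwa [show 1 + n = n + 1 from add_comm 1 n] at h

theorem prod_soul_eq_zero {κ : Type} [Fintype κ] {n : ℕ} (hn : Fintype.card κ < n)
    (y : Fin n → evenPart κ) : ∏ l, soul (y l) = 0 := by
  have h := prod_soul_mem y
  rw [degGE_eq_bot κ n hn, Submodule.mem_bot] at h
  exact Subtype.ext h

/-! ### Adding odd generators -/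

/-- The inclusion of Grassmann algebras induced by a map of generators. -/
def incl {κ κ' : Type} [Fintype κ] [DecidableEq κ'] (t : κ → κ') :
    Grassmann κ →ₐ[ℝ] Grassmann κ' :=
  ExteriorAlgebra.map (Fintype.linearCombination ℝ (fun k => Pi.single (t k) (1 : ℝ)))

theorem incl_theta {κ κ' : Type} [Fintype κ] [DecidableEq κ] [DecidableEq κ'] (t : κ → κ')
    (k : κ) : incl t (theta k) = theta (t k) := by
  rw [incl, theta, theta, ExteriorAlgebra.map_apply_ι]
  simp [Fintype.linearCombination_apply]

theorem incl_mem {κ κ' : Type} [Fintype κ] [DecidableEq κ'] (t : κ → κ') {p : ZMod 2}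
    {x : Grassmann κ} (hx : x ∈ parityPart κ p) : incl t x ∈ parityPart κ' p := by
  have h : parityPart κ p ≤ (parityPart κ' p).comap (incl t).toLinearMap := by
    refine iSup_le fun j => ?_
    have h2 : LinearMap.range (CliffordAlgebra.ι (0 : QuadraticForm ℝ (κ' → ℝ))) ^ (j : ℕ)
        ≤ parityPart κ' p :=
      le_iSup (fun j : {n : ℕ // (n : ZMod 2) = p} =>
        LinearMap.range (CliffordAlgebra.ι (0 : QuadraticForm ℝ (κ' → ℝ))) ^ (j : ℕ)) j
    rw [← Submodule.map_le_iff_le_comap]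
    refine le_trans ?_ h2
    rw [Submodule.map_pow]
    refine pow_le_pow_left' ?_ _
    rintro _ ⟨_, ⟨v, rfl⟩, rfl⟩
    exact ⟨_, (ExteriorAlgebra.map_apply_ι _ _).symm⟩
  exact h hx

theorem body_incl {κ κ' : Type} [Fintype κ] [DecidableEq κ'] (t : κ → κ') (x : Grassmann κ) :
    body (incl t x) = body x := by
  have h : (body.comp (incl t) : Grassmann κ →ₐ[ℝ] ℝ) = body := by
    refine ExteriorAlgebra.hom_ext (LinearMap.ext fun v => ?_)
    simp [body, incl, ExteriorAlgebra.algebraMapInv]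
  exact DFunLike.congr_fun h x

/-- The inclusion on even elements. -/
def inclEven {κ κ' : Type} [Fintype κ] [DecidableEq κ'] (t : κ → κ') :
    evenPart κ →ₐ[ℝ] evenPart κ' :=
  ((incl t).comp (evenPart κ).val).codRestrict (evenPart κ') fun x => incl_mem t x.2

/-- The inclusion on odd elements. -/
def inclOdd {κ κ' : Type} [Fintype κ] [DecidableEq κ'] (t : κ → κ') (x : parityPart κ 1) :
    parityPart κ' 1 := ⟨incl t x.1, incl_mem t x.2⟩

theorem soul_inclEven {κ κ' : Type} [Fintype κ] [DecidableEq κ'] (t : κ → κ') (y : evenPart κ) :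
    soul (inclEven t y) = inclEven t (soul y) := by
  rw [soul, soul, map_sub, AlgHom.commutes]
  congr 2
  exact body_incl t _

theorem contractLeft_incl {κ κ' : Type} [Fintype κ] [DecidableEq κ'] (t : κ → κ')
    (d : Module.Dual ℝ (κ' → ℝ)) (x : Grassmann κ) :
    CliffordAlgebra.contractLeft d (incl t x) =
      incl t (CliffordAlgebra.contractLeft
        (d ∘ₗ Fintype.linearCombination ℝ (fun k => Pi.single (t k) (1 : ℝ))) x) := by
  induction x using CliffordAlgebra.left_induction with
  | algebraMap r =>
    rw [AlgHom.commutes, CliffordAlgebra.contractLeft_algebraMap,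
      CliffordAlgebra.contractLeft_algebraMap, map_zero]
  | add x y hx hy => simp only [map_add, hx, hy]
  | ι_mul x v hx =>
    have h : incl t (CliffordAlgebra.ι (0 : QuadraticForm ℝ (κ → ℝ)) v) =
        CliffordAlgebra.ι (0 : QuadraticForm ℝ (κ' → ℝ))
          (Fintype.linearCombination ℝ (fun k => Pi.single (t k) (1 : ℝ)) v) :=
      ExteriorAlgebra.map_apply_ι _ _
    rw [map_mul, h, CliffordAlgebra.contractLeft_ι_mul, hx, CliffordAlgebra.contractLeft_ι_mul,
      map_sub, map_mul, map_smul, h]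
    rfl

/-! ### Adding coordinates to a superfunction -/

/-- The superfunction `f` viewed as a function of more coordinates. -/
def lift {ι ι' κ κ' : Type} [Fintype κ] [DecidableEq κ'] (s : ι → ι') (t : κ → κ')
    (f : (ι → ℝ) → Grassmann κ) (x : ι' → ℝ) : Grassmann κ' :=
  incl t (f (x ∘ s))

/-- `incl` as a continuous linear map. -/
def inclCLM {κ κ' : Type} [Fintype κ] [Finite κ'] [DecidableEq κ'] (t : κ → κ') :
    Grassmann κ →L[ℝ] Grassmann κ' :=
  LinearMap.toContinuousLinearMap (incl t).toLinearMap

/-- Restriction of coordinates as a continuous linear map. -/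
def restrCLM {ι ι' : Type} (s : ι → ι') : (ι' → ℝ) →L[ℝ] (ι → ℝ) :=
  ContinuousLinearMap.pi fun a => ContinuousLinearMap.proj (s a)

theorem lift_eq {ι ι' κ κ' : Type} [Fintype κ] [Finite κ'] [DecidableEq κ'] (s : ι → ι')
    (t : κ → κ') (f : (ι → ℝ) → Grassmann κ) :
    lift s t f = inclCLM t ∘ f ∘ restrCLM s := rfl

theorem restrCLM_single {ι ι' : Type} [DecidableEq ι] [DecidableEq ι'] {s : ι → ι'}
    (hs : Function.Injective s) (a : ι) :
    restrCLM s (Pi.single (s a) 1) = Pi.single a 1 := by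
  ext b
  simp [restrCLM, Pi.single_apply, hs.eq_iff]

theorem restrCLM_single_of_notMem {ι ι' : Type} [DecidableEq ι'] {s : ι → ι'} {a : ι'}
    (ha : a ∉ Set.range s) : restrCLM s (Pi.single a 1) = 0 := by
  ext b
  have : s b ≠ a := fun h => ha ⟨b, h⟩
  simp [restrCLM, this]

theorem contDiffAt_lift {ι ι' κ κ' : Type} [Fintype ι] [Fintype ι'] [Fintype κ] [Fintype κ']
    [DecidableEq κ'] (s : ι → ι') (t : κ → κ') {f : (ι → ℝ) → Grassmann κ} {x : ι' → ℝ}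
    {n : WithTop ℕ∞} (hf : ContDiffAt ℝ n f (x ∘ s)) : ContDiffAt ℝ n (lift s t f) x := by
  rw [lift_eq]
  exact (inclCLM t).contDiff.contDiffAt.comp x
    (ContDiffAt.comp x (by exact hf) (restrCLM s).contDiff.contDiffAt)

theorem iteratedFDeriv_lift {ι ι' κ κ' : Type} [Fintype ι] [Fintype ι'] [Fintype κ] [Fintype κ']
    [DecidableEq κ'] (s : ι → ι') (t : κ → κ') {f : (ι → ℝ) → Grassmann κ} {x : ι' → ℝ}
    (hf : ContDiffAt ℝ ∞ f (x ∘ s)) (n : ℕ) (v : Fin n → ι' → ℝ) :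
    iteratedFDeriv ℝ n (lift s t f) x v =
      incl t (iteratedFDeriv ℝ n f (x ∘ s) (fun l => restrCLM s (v l))) := by
  have hn : ContDiffAt ℝ n f (x ∘ s) := hf.of_le (by exact_mod_cast le_top)
  obtain ⟨u, hu, hfu⟩ := hn.contDiffOn le_rfl (by simp)
  obtain ⟨w, hwu, hwo, hxw⟩ := mem_nhds_iff.mp (by simpa using hu)
  have hfw := hfu.mono hwu
  have hcomp : ContDiffAt ℝ n (f ∘ restrCLM s) x :=
    ContDiffAt.comp x (by exact hn) (restrCLM s).contDiff.contDiffAt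
  rw [lift_eq, (inclCLM t).iteratedFDeriv_comp_left hcomp le_rfl]
  have hpre : IsOpen (restrCLM s ⁻¹' w) := hwo.preimage (restrCLM s).continuous
  have h := (restrCLM s).iteratedFDerivWithin_comp_right hfw hwo.uniqueDiffOn
    hpre.uniqueDiffOn (x := x) hxw le_rfl
  rw [iteratedFDerivWithin_of_isOpen n hpre hxw, iteratedFDerivWithin_of_isOpen n hwo (show restrCLM s x ∈ w from hxw)] at h
  rw [h]
  rfl

theorem partialD_lift_inl {ι ι' κ κ' : Type} [Fintype ι] [DecidableEq ι] [Fintype ι']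
    [DecidableEq ι'] [Fintype κ] [Fintype κ'] [DecidableEq κ'] {s : ι → ι'}
    (hs : Function.Injective s) (t : κ → κ') {f : (ι → ℝ) → Grassmann κ} {x : ι' → ℝ}
    (hf : ContDiffAt ℝ ∞ f (x ∘ s)) (a : ι) :
    partialD (Sum.inl (s a)) (lift s t f) x = incl t (partialD (Sum.inl a) f (x ∘ s)) := by
  have h := iteratedFDeriv_lift s t hf 1 (fun _ => Pi.single (s a) 1)
  simpa [iteratedFDeriv_one_apply, restrCLM_single hs, partialD] using h

theorem partialD_lift_inl_of_notMem {ι ι' κ κ' : Type} [Fintype ι] [Fintype ι']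
    [DecidableEq ι'] [Fintype κ] [Fintype κ'] [DecidableEq κ'] {s : ι → ι'}
    (t : κ → κ') {f : (ι → ℝ) → Grassmann κ} {x : ι' → ℝ}
    (hf : ContDiffAt ℝ ∞ f (x ∘ s)) {a : ι'} (ha : a ∉ Set.range s) :
    partialD (Sum.inl a) (lift s t f) x = 0 := by
  have h := iteratedFDeriv_lift s t hf 1 (fun _ => Pi.single a 1)
  simpa [iteratedFDeriv_one_apply, restrCLM_single_of_notMem ha, partialD] using h

theorem partialD_lift_inr {ι ι' κ κ' : Type} [Fintype ι] [DecidableEq ι] [Fintype ι']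
    [DecidableEq ι'] [Fintype κ] [DecidableEq κ] [Fintype κ'] [DecidableEq κ'] (s : ι → ι') {t : κ → κ'}
    (ht : Function.Injective t) (f : (ι → ℝ) → Grassmann κ) (x : ι' → ℝ) (k : κ) :
    partialD (Sum.inr (t k)) (lift s t f) x = incl t (partialD (Sum.inr k) f (x ∘ s)) := by
  simp only [partialD, Sum.elim_inr, lift, contractLeft_incl]
  congr 3
  refine LinearMap.ext fun v => ?_
  simp [Fintype.linearCombination_apply, Pi.single_apply, ht.eq_iff]

theorem partialD_lift_inr_of_notMem {ι ι' κ κ' : Type} [Fintype ι'] [DecidableEq ι'] [Fintype κ]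
    [Fintype κ'] [DecidableEq κ'] (s : ι → ι') {t : κ → κ'} (f : (ι → ℝ) → Grassmann κ)
    (x : ι' → ℝ) {k : κ'} (hk : k ∉ Set.range t) :
    partialD (Sum.inr k) (lift s t f) x = 0 := by
  simp only [partialD, Sum.elim_inr, lift, contractLeft_incl]
  have h : (LinearMap.proj k : Module.Dual ℝ (κ' → ℝ)) ∘ₗ
      Fintype.linearCombination ℝ (fun k => Pi.single (t k) (1 : ℝ)) = 0 := by
    refine LinearMap.ext fun v => ?_
    have : ∀ j, k ≠ t j := fun j h => hk ⟨j, h.symm⟩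
    simp [Fintype.linearCombination_apply, this]
  rw [h]
  simp

theorem subst_lift {ι ι' κ κ' μ μ' : Type} [Fintype ι] [DecidableEq ι] [Fintype ι']
    [DecidableEq ι'] [Fintype κ] [DecidableEq κ] [Fintype κ'] [DecidableEq κ'] [Fintype μ]
    [Fintype μ'] [DecidableEq μ'] {s : ι → ι'} (hs : Function.Injective s) {t : κ → κ'}
    {u : μ → μ'} (hu : Function.Injective u) {z : Point ι κ μ} {w : Point ι' κ' μ'}
    (he : ∀ a, w.even (s a) = inclEven u (z.even a))
    (ho : ∀ k, w.odd (t k) = inclOdd u (z.odd k))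
    {f : (ι → ℝ) → Grassmann κ} (hf : ContDiffAt ℝ ∞ f z.base) :
    subst (lift s t f) w = incl u (subst f z) := by
  have hb : w.base ∘ s = z.base := by
    funext a
    simp only [Point.base, Function.comp_apply, he]
    exact body_incl u _
  have hodd : ∀ y, w.oddSubst (incl t y) = incl u (z.oddSubst y) := by
    intro y
    have h : w.oddSubst.comp (incl t) = (incl u).comp z.oddSubst := by
      refine ExteriorAlgebra.hom_ext (LinearMap.ext fun v => ?_)
      simp [Point.oddSubst, incl, Fintype.linearCombination_apply, ho, inclOdd]
    exact DFunLike.congr_fun h y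
  have hterm : ∀ n, (∑ a : Fin n → ι',
      w.oddSubst (iteratedFDeriv ℝ n (lift s t f) w.base (fun l => Pi.single (a l) 1)) *
        ((∏ l, soul (w.even (a l)) : evenPart μ') : Grassmann μ')) =
      incl u (∑ a : Fin n → ι,
      z.oddSubst (iteratedFDeriv ℝ n f z.base (fun l => Pi.single (a l) 1)) *
        ((∏ l, soul (z.even (a l)) : evenPart μ) : Grassmann μ)) := by
    intro n
    rw [map_sum]
    symm
    refine Finset.sum_of_injOn (fun a => s ∘ a) (hs.comp_left.injOn) (by simp) ?_ ?_
    · intro b _ hb'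
      have : ∃ l, b l ∉ Set.range s := by
        by_contra! hc
        choose a ha using hc
        exact hb' ⟨a, by simp, funext ha⟩
      obtain ⟨l, hl⟩ := this
      rw [iteratedFDeriv_lift s t (by rwa [hb]),
        ContinuousMultilinearMap.map_coord_zero _ l (restrCLM_single_of_notMem hl)]
      simp
    · intro a _
      rw [iteratedFDeriv_lift s t (by rwa [hb]), hodd, hb, map_mul]
      simp only [Function.comp_apply, restrCLM_single hs, he, soul_inclEven]
      rw [← map_prod]
      rfl
  have hcard : Fintype.card μ + 1 ≤ Fintype.card μ' + 1 :=
    Nat.succ_le_succ (Fintype.card_le_of_injective u hu)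
  rw [subst, subst, map_sum]
  simp only [hterm, map_smul]
  symm
  refine Finset.sum_subset (Finset.range_mono hcard) fun n _ hn => ?_
  have hn' : Fintype.card μ < n := by simpa using hn
  simp [prod_soul_eq_zero hn']

theorem subst_congr {ι κ μ : Type} [Fintype ι] [DecidableEq ι] [Fintype κ] [Fintype μ]
    {f g : (ι → ℝ) → Grassmann κ} {z : Point ι κ μ}
    (h : f =ᶠ[nhds z.base] g) : subst f z = subst g z := by
  simp only [subst]
  refine Finset.sum_congr rfl fun n _ => ?_
  rw [(h.iteratedFDeriv ℝ n).eq_of_nhds]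

theorem subst_add {ι κ μ : Type} [Fintype ι] [DecidableEq ι] [Fintype κ] [Fintype μ]
    {f g : (ι → ℝ) → Grassmann κ} {z : Point ι κ μ}
    (hf : ContDiffAt ℝ ∞ f z.base) (hg : ContDiffAt ℝ ∞ g z.base) :
    subst (f + g) z = subst f z + subst g z := by
  simp only [subst, ← Finset.sum_add_distrib, ← smul_add]
  refine Finset.sum_congr rfl fun n _ => ?_
  have hn : (n : WithTop ℕ∞) ≤ ∞ := by exact_mod_cast le_top
  rw [iteratedFDeriv_add_apply (hf.of_le hn) (hg.of_le hn)]
  simp [add_mul]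

theorem subst_smul {ι κ μ : Type} [Fintype ι] [DecidableEq ι] [Fintype κ] [Fintype μ]
    {f : (ι → ℝ) → Grassmann κ} {z : Point ι κ μ} (c : ℝ)
    (hf : ContDiffAt ℝ ∞ f z.base) :
    subst (c • f) z = c • subst f z := by
  simp only [subst, Finset.smul_sum, smul_comm c]
  refine Finset.sum_congr rfl fun n _ => ?_
  have hn : (n : WithTop ℕ∞) ≤ ∞ := by exact_mod_cast le_top
  rw [iteratedFDeriv_const_smul_apply (hf.of_le hn)]
  simp

theorem subst_zero {ι κ μ : Type} [Fintype ι] [DecidableEq ι] [Fintype κ] [Fintype μ]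
    (z : Point ι κ μ) : subst (0 : (ι → ℝ) → Grassmann κ) z = 0 := by
  have h := subst_smul (z := z) (f := (0 : (ι → ℝ) → Grassmann κ)) 0 contDiffAt_const
  simpa using h

/-! ### Supermanifolds -/

/-- A supermanifold of dimension `ι|κ`, presented by an atlas: a Hausdorff second countable space,
charts onto open subsets of `ℝ^ι`, and for all charts `i`, `j` the expression
`trans i j = (x'(x, θ), θ'(x, θ))` of the coordinates of `j` as smooth superfunctions of the
coordinates of `i`, subject to the cocycle condition. -/
structure Supermanifold.{u, v} (ι κ : Type) [Fintype ι] [DecidableEq ι] [Fintype κ]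
    [DecidableEq κ] where
  carrier : Type u
  [topology : TopologicalSpace carrier]
  [t2 : T2Space carrier]
  [secondCountable : SecondCountableTopology carrier]
  index : Type v
  chart : index → OpenPartialHomeomorph carrier (ι → ℝ)
  cover : ∀ p, ∃ i, p ∈ (chart i).source
  trans : index → index → (ι → ℝ) → Point ι κ κ
  smooth_trans : ∀ i j a, ContDiffOn ℝ ∞ (fun x => (trans i j x).coord a)
    ((chart i).symm.trans (chart j)).source
  base_trans : ∀ i j, ∀ x ∈ ((chart i).symm.trans (chart j)).source,
    (trans i j x).base = chart j ((chart i).symm x)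
  trans_self : ∀ i, ∀ x ∈ (chart i).target, trans i i x = Point.self x
  cocycle : ∀ i j k, ∀ x ∈ ((chart i).symm.trans (chart j)).source,
    x ∈ ((chart i).symm.trans (chart k)).source → ∀ a,
      (trans i k x).coord a = subst (fun y => (trans j k y).coord a) (trans i j x)

attribute [instance] Supermanifold.topology Supermanifold.t2 Supermanifold.secondCountable

namespace Supermanifold

section
variable {ι κ : Type} [Fintype ι] [DecidableEq ι] [Fintype κ] [DecidableEq κ]

/-- The set of points in the chart `i` that also belong to the chart `j`. -/
def overlap (M : Supermanifold ι κ) (i j : M.index) : Set (ι → ℝ) :=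
  ((M.chart i).symm.trans (M.chart j)).source

/-- The Jacobian supermatrix `∂x'^b / ∂x^a` (row `a`, column `b`) of the change of coordinates
from the chart `i` to the chart `j`. -/
def jacobian (M : Supermanifold ι κ) (i j : M.index) (x : ι → ℝ) :
    Matrix (ι ⊕ κ) (ι ⊕ κ) (Grassmann κ) :=
  Matrix.of fun a b => partialD a (fun y => (M.trans i j y).coord b) x

theorem isOpen_overlap (M : Supermanifold ι κ) (i j : M.index) : IsOpen (M.overlap i j) :=
  ((M.chart i).symm.trans (M.chart j)).open_source

theorem mem_overlap {M : Supermanifold ι κ} {i j : M.index} {x : ι → ℝ} :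
    x ∈ M.overlap i j ↔ x ∈ (M.chart i).target ∧ (M.chart i).symm x ∈ (M.chart j).source := by
  simp [overlap]

theorem base_mem_target {M : Supermanifold ι κ} {i j : M.index} {x : ι → ℝ}
    (hx : x ∈ M.overlap i j) : (M.trans i j x).base ∈ (M.chart j).target := by
  rw [M.base_trans i j x hx]
  exact (M.chart j).map_source (mem_overlap.mp hx).2

theorem base_mem_overlap {M : Supermanifold ι κ} {i j k : M.index} {x : ι → ℝ}
    (hx : x ∈ M.overlap i j) (hk : x ∈ M.overlap i k) :
    (M.trans i j x).base ∈ M.overlap j k := by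
  refine mem_overlap.mpr ⟨base_mem_target hx, ?_⟩
  rw [M.base_trans i j x hx, (M.chart j).left_inv (mem_overlap.mp hx).2]
  exact (mem_overlap.mp hk).2

theorem contDiffAt_trans (M : Supermanifold ι κ) {i j : M.index} {x : ι → ℝ}
    (hx : x ∈ M.overlap i j) (a : ι ⊕ κ) :
    ContDiffAt ℝ ∞ (fun y => (M.trans i j y).coord a) x :=
  (M.smooth_trans i j a).contDiffAt ((M.isOpen_overlap i j).mem_nhds hx)

/-- The space `C^∞(M)` of functions: compatible families of smooth superfunctions on the charts.
Outside of its domain the expression in a chart is put to be zero. -/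
def functions (M : Supermanifold ι κ) : Submodule ℝ (M.index → (ι → ℝ) → Grassmann κ) where
  carrier := {f | (∀ i, ContDiffOn ℝ ∞ (f i) (M.chart i).target) ∧
    (∀ i, ∀ x ∉ (M.chart i).target, f i x = 0) ∧
    ∀ i j, ∀ x ∈ M.overlap i j, f i x = subst (f j) (M.trans i j x)}
  add_mem' := by
    rintro f g ⟨hf1, hf2, hf3⟩ ⟨hg1, hg2, hg3⟩
    refine ⟨fun i => (hf1 i).add (hg1 i), fun i x hx => ?_, fun i j x hx => ?_⟩
    · simp [hf2 i x hx, hg2 i x hx]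
    · have hb := (M.chart j).open_target.mem_nhds (base_mem_target hx)
      have h := subst_add ((hf1 j).contDiffAt hb) ((hg1 j).contDiffAt hb)
      simp only [Pi.add_apply, hf3 i j x hx, hg3 i j x hx]
      exact h.symm
  zero_mem' := ⟨fun i => contDiffOn_const, fun i x _ => rfl, fun i j x _ => (subst_zero _).symm⟩
  smul_mem' := by
    rintro c f ⟨hf1, hf2, hf3⟩
    refine ⟨fun i => (hf1 i).const_smul c, fun i x hx => ?_, fun i j x hx => ?_⟩
    · simp [hf2 i x hx]
    · have hb := (M.chart j).open_target.mem_nhds (base_mem_target hx)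
      have h := subst_smul c ((hf1 j).contDiffAt hb)
      simp only [Pi.smul_apply, hf3 i j x hx]
      exact h.symm

theorem contDiffAt_of_mem {M : Supermanifold ι κ} {f : M.index → (ι → ℝ) → Grassmann κ}
    (hf : f ∈ M.functions) {i : M.index} {x : ι → ℝ}
    (hx : x ∈ (M.chart i).target) : ContDiffAt ℝ ∞ (f i) x :=
  (hf.1 i).contDiffAt ((M.chart i).open_target.mem_nhds hx)

/-- A vector field of parity `p`: its components in all charts, for the local expression
`X = X^a ∂/∂x^a`, with the transformation law `X'^b = X^a ∂x'^b/∂x^a`. -/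
structure VectorField (M : Supermanifold ι κ) (p : ZMod 2) where
  comp : M.index → ι ⊕ κ → (ι → ℝ) → Grassmann κ
  smooth_comp : ∀ i a, ContDiffOn ℝ ∞ (comp i a) (M.chart i).target
  parity_comp : ∀ i a, ∀ x ∈ (M.chart i).target, comp i a x ∈ parityPart κ (coordParity a + p)
  comp_trans : ∀ i j, ∀ x ∈ M.overlap i j, ∀ b,
    subst (comp j b) (M.trans i j x) =
      ∑ a, comp i a x * partialD a (fun y => (M.trans i j y).coord b) x

/-- The action `X^a ∂f/∂x^a` of a vector field on a local superfunction in the chart `i`. -/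
def VectorField.act {M : Supermanifold ι κ} {p : ZMod 2} (X : M.VectorField p) (i : M.index)
    (f : (ι → ℝ) → Grassmann κ) (x : ι → ℝ) : Grassmann κ :=
  ∑ a, X.comp i a x * partialD a f x

theorem VectorField.contDiffAt_comp {M : Supermanifold ι κ} {p : ZMod 2} (X : M.VectorField p)
    {i : M.index} {x : ι → ℝ} (hx : x ∈ (M.chart i).target) (a : ι ⊕ κ) :
    ContDiffAt ℝ ∞ (X.comp i a) x :=
  (X.smooth_comp i a).contDiffAt ((M.chart i).open_target.mem_nhds hx)

/-- A Berezin volume: a nowhere vanishing even section `D[x] ρ(x)` of the Berezin bundle, whose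
coordinate volume elements transform by `D[x'] = D[x] Ber(∂x'/∂x)`. -/
structure BerezinVolume (M : Supermanifold ι κ) where
  density : M.index → (ι → ℝ) → Grassmann κ
  smooth_density : ∀ i, ContDiffOn ℝ ∞ (density i) (M.chart i).target
  even_density : ∀ i, ∀ x ∈ (M.chart i).target, density i x ∈ parityPart κ 0
  isUnit_density : ∀ i, ∀ x ∈ (M.chart i).target, IsUnit (density i x)
  density_trans : ∀ i j, ∀ x ∈ M.overlap i j,
    density i x = berezinian (M.jacobian i j x) * subst (density j) (M.trans i j x)

/-- The Lie derivative of a Berezin form `D[x] s(x)` in the chart `i`. -/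
def VectorField.lieDeriv {M : Supermanifold ι κ} {p : ZMod 2} (X : M.VectorField p) (i : M.index)
    (s : (ι → ℝ) → Grassmann κ) (x : ι → ℝ) : Grassmann κ :=
  ∑ a, (-1 : ℤˣ) ^ (coordParity a * (p + 1)) • partialD a (fun y => X.comp i a y * s y) x

/-- `d` is the divergence of `X` with respect to `ρ`, i.e. `ρ d = L_X ρ`. -/
def VectorField.IsDivergence {M : Supermanifold ι κ} {p : ZMod 2} (X : M.VectorField p)
    (ρ : M.BerezinVolume) (d : M.index → (ι → ℝ) → Grassmann κ) :
    Prop :=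
  d ∈ M.functions ∧
  ∀ i, ∀ x ∈ (M.chart i).target, ρ.density i x * d i x = X.lieDeriv i (ρ.density i) x

end

end Supermanifold

section
variable {ι κ : Type} [Fintype ι] [DecidableEq ι] [Fintype κ]

theorem partialD_add (a : ι ⊕ κ) {f g : (ι → ℝ) → Grassmann κ} {x : ι → ℝ}
    (hf : ContDiffAt ℝ ∞ f x) (hg : ContDiffAt ℝ ∞ g x) :
    partialD a (f + g) x = partialD a f x + partialD a g x := by
  rcases a with a | k
  · simp [partialD, fderiv_add (hf.differentiableAt (by simp)) (hg.differentiableAt (by simp))]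
  · simp [partialD]

theorem partialD_smul (a : ι ⊕ κ) (c : ℝ) {f : (ι → ℝ) → Grassmann κ} {x : ι → ℝ}
    (hf : ContDiffAt ℝ ∞ f x) : partialD a (c • f) x = c • partialD a f x := by
  rcases a with a | k
  · simp [partialD, fderiv_const_smul (hf.differentiableAt (by simp))]
  · simp [partialD]

theorem partialD_zero (a : ι ⊕ κ) (x : ι → ℝ) :
    partialD a (0 : (ι → ℝ) → Grassmann κ) x = 0 := by
  rcases a with a | k <;> simp [partialD]

theorem partialD_congr (a : ι ⊕ κ) {f g : (ι → ℝ) → Grassmann κ} {x : ι → ℝ}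
    (h : f =ᶠ[nhds x] g) : partialD a f x = partialD a g x := by
  rcases a with a | k
  · simp [partialD, h.fderiv_eq]
  · simp [partialD, h.eq_of_nhds]

end

namespace Supermanifold.VectorField

section
variable {ι κ : Type} [Fintype ι] [DecidableEq ι] [Fintype κ] [DecidableEq κ]
  {M : Supermanifold ι κ} {p : ZMod 2} (X : M.VectorField p) (i : M.index)

theorem act_add {f g : (ι → ℝ) → Grassmann κ} {x : ι → ℝ}
    (hf : ContDiffAt ℝ ∞ f x) (hg : ContDiffAt ℝ ∞ g x) :
    X.act i (f + g) x = X.act i f x + X.act i g x := by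
  simp [act, partialD_add _ hf hg, mul_add, Finset.sum_add_distrib]

theorem act_smul (c : ℝ) {f : (ι → ℝ) → Grassmann κ} {x : ι → ℝ}
    (hf : ContDiffAt ℝ ∞ f x) : X.act i (c • f) x = c • X.act i f x := by
  simp [act, partialD_smul _ c hf, Finset.smul_sum]

theorem act_zero (x : ι → ℝ) : X.act i 0 x = 0 := by
  simp [act, partialD_zero]

end

end Supermanifold.VectorField

/-! ### Q-manifolds and their standard cohomology -/

/-- A Q-manifold: a supermanifold with an odd vector field `Q` such that `Q² = 0`, that is,
`Q^a ∂Q^b/∂x^a = 0` in all charts. -/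
structure QManifold.{u, v} (ι κ : Type) [Fintype ι] [DecidableEq ι] [Fintype κ] [DecidableEq κ]
    extends Supermanifold.{u, v} ι κ where
  Q : toSupermanifold.VectorField 1
  Q_sq : ∀ i, ∀ x ∈ (chart i).target, ∀ b, Q.act i (Q.comp i b) x = 0

namespace QManifold

section
variable {ι κ : Type} [Fintype ι] [DecidableEq ι] [Fintype κ] [DecidableEq κ]

/-- The cocycles of the standard complex `(C^∞(M), Q)`: the functions `f` with `Q f = 0`. -/
def cocycles (M : QManifold ι κ) : Submodule ℝ (M.index → (ι → ℝ) → Grassmann κ) where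
  carrier := {f | f ∈ M.functions ∧ ∀ i, ∀ x ∈ (M.chart i).target, M.Q.act i (f i) x = 0}
  add_mem' := by
    rintro f g ⟨hf, hf'⟩ ⟨hg, hg'⟩
    refine ⟨add_mem hf hg, fun i x hx => ?_⟩
    have h := M.Q.act_add i (Supermanifold.contDiffAt_of_mem hf hx)
      (Supermanifold.contDiffAt_of_mem hg hx)
    rw [hf' i x hx, hg' i x hx, add_zero] at h
    exact h
  zero_mem' := ⟨zero_mem _, fun i x _ => M.Q.act_zero i x⟩
  smul_mem' := by
    rintro c f ⟨hf, hf'⟩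
    refine ⟨M.functions.smul_mem c hf, fun i x hx => ?_⟩
    have h := M.Q.act_smul i c (Supermanifold.contDiffAt_of_mem hf hx)
    rw [hf' i x hx, smul_zero] at h
    exact h

/-- The coboundaries of the standard complex: the functions `f = Q g` with `g ∈ C^∞(M)`. -/
def coboundaries (M : QManifold ι κ) : Submodule ℝ (M.index → (ι → ℝ) → Grassmann κ) where
  carrier := {f | f ∈ M.functions ∧ ∃ g ∈ M.functions, ∀ i, ∀ x ∈ (M.chart i).target,
    f i x = M.Q.act i (g i) x}
  add_mem' := by
    rintro f f' ⟨hf, g, hg, hfg⟩ ⟨hf', g', hg', hfg'⟩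
    refine ⟨add_mem hf hf', g + g', add_mem hg hg', fun i x hx => ?_⟩
    have h := M.Q.act_add i (Supermanifold.contDiffAt_of_mem hg hx)
      (Supermanifold.contDiffAt_of_mem hg' hx)
    rw [← hfg i x hx, ← hfg' i x hx] at h
    exact h.symm
  zero_mem' := ⟨zero_mem _, 0, zero_mem _, fun i x _ => (M.Q.act_zero i x).symm⟩
  smul_mem' := by
    rintro c f ⟨hf, g, hg, hfg⟩
    refine ⟨M.functions.smul_mem c hf, c • g, M.functions.smul_mem c hg, fun i x hx => ?_⟩
    have h := M.Q.act_smul i c (Supermanifold.contDiffAt_of_mem hg hx)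
    rw [← hfg i x hx] at h
    exact h.symm

/-- The standard cohomology of a Q-manifold: cocycles modulo coboundaries. -/
abbrev Cohomology (M : QManifold ι κ) : Type _ :=
  M.cocycles ⧸ M.coboundaries.submoduleOf M.cocycles

/-- The standard cohomology class of a cocycle. -/
def cohomologyClass (M : QManifold ι κ) (f : M.cocycles) : M.Cohomology :=
  Submodule.Quotient.mk f

/-- `c` is the modular class of `M`: the standard cohomology class of `Div_ρ Q`, for a Berezin
volume `ρ`. -/
def IsModularClass (M : QManifold ι κ) (c : M.Cohomology) : Prop :=
  ∃ (ρ : M.BerezinVolume) (d : M.cocycles),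
    M.Q.IsDivergence ρ d ∧ M.cohomologyClass d = c

end

end QManifold

/-! ### Products -/

section
variable {ι₁ κ₁ ι₂ κ₂ : Type} [Fintype ι₁] [DecidableEq ι₁] [Fintype κ₁] [DecidableEq κ₁]
  [Fintype ι₂] [DecidableEq ι₂] [Fintype κ₂] [DecidableEq κ₂]

/-- The functions of the coordinates `(x, θ)` of the first factor as functions on a product. -/
abbrev liftFst (f : (ι₁ → ℝ) → Grassmann κ₁) : (ι₁ ⊕ ι₂ → ℝ) → Grassmann (κ₁ ⊕ κ₂) :=
  lift Sum.inl Sum.inl f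

/-- The functions of the coordinates `(y, η)` of the second factor as functions on a product. -/
abbrev liftSnd (f : (ι₂ → ℝ) → Grassmann κ₂) : (ι₁ ⊕ ι₂ → ℝ) → Grassmann (κ₁ ⊕ κ₂) :=
  lift Sum.inr Sum.inr f

/-- The pair of two values of coordinates. -/
def Point.prod {μ₁ μ₂ : Type} [Fintype μ₁] [DecidableEq μ₁] [Fintype μ₂] [DecidableEq μ₂]
    (z : Point ι₁ κ₁ μ₁) (w : Point ι₂ κ₂ μ₂) : Point (ι₁ ⊕ ι₂) (κ₁ ⊕ κ₂) (μ₁ ⊕ μ₂) where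
  even := Sum.elim (fun a => inclEven Sum.inl (z.even a)) (fun a => inclEven Sum.inr (w.even a))
  odd := Sum.elim (fun k => inclOdd Sum.inl (z.odd k)) (fun k => inclOdd Sum.inr (w.odd k))

/-- Families indexed by the coordinates of a product, from families for the two factors. -/
def sumIndex {α : Type*} (u : ι₁ ⊕ κ₁ → α) (v : ι₂ ⊕ κ₂ → α) : (ι₁ ⊕ ι₂) ⊕ (κ₁ ⊕ κ₂) → α :=
  Sum.elim (Sum.elim (fun a => u (Sum.inl a)) (fun a => v (Sum.inl a)))
    (Sum.elim (fun k => u (Sum.inr k)) (fun k => v (Sum.inr k)))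

theorem coord_prod {μ₁ μ₂ : Type} [Fintype μ₁] [DecidableEq μ₁] [Fintype μ₂] [DecidableEq μ₂]
    (z : Point ι₁ κ₁ μ₁) (w : Point ι₂ κ₂ μ₂) :
    (z.prod w).coord = sumIndex (fun a => incl Sum.inl (z.coord a))
      (fun a => incl Sum.inr (w.coord a)) := by
  funext a
  rcases a with (a | a) | (a | a) <;> rfl

theorem base_prod {μ₁ μ₂ : Type} [Fintype μ₁] [DecidableEq μ₁] [Fintype μ₂] [DecidableEq μ₂]
    (z : Point ι₁ κ₁ μ₁) (w : Point ι₂ κ₂ μ₂) :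
    (z.prod w).base = Sum.elim z.base w.base := by
  funext a
  rcases a with a | a <;> exact body_incl _ _

theorem self_prod (x : ι₁ ⊕ ι₂ → ℝ) :
    (Point.self (κ := κ₁) (x ∘ Sum.inl)).prod (Point.self (κ := κ₂) (x ∘ Sum.inr)) =
      Point.self x := by
  simp only [Point.prod, Point.self, Point.mk.injEq]
  refine ⟨funext fun a => ?_, funext fun k => ?_⟩
  · rcases a with a | a <;> simp
  · rcases k with k | k <;> exact Subtype.ext (incl_theta _ _)

theorem subst_liftFst {μ₁ μ₂ : Type} [Fintype μ₁] [DecidableEq μ₁] [Fintype μ₂] [DecidableEq μ₂]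
    (z : Point ι₁ κ₁ μ₁) (w : Point ι₂ κ₂ μ₂) {f : (ι₁ → ℝ) → Grassmann κ₁}
    (hf : ContDiffAt ℝ ∞ f z.base) :
    subst (liftFst f) (z.prod w) = incl Sum.inl (subst f z) :=
  subst_lift Sum.inl_injective Sum.inl_injective (fun _ => rfl) (fun _ => rfl) hf

theorem subst_liftSnd {μ₁ μ₂ : Type} [Fintype μ₁] [DecidableEq μ₁] [Fintype μ₂] [DecidableEq μ₂]
    (z : Point ι₁ κ₁ μ₁) (w : Point ι₂ κ₂ μ₂) {f : (ι₂ → ℝ) → Grassmann κ₂}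
    (hf : ContDiffAt ℝ ∞ f w.base) :
    subst (liftSnd f) (z.prod w) = incl Sum.inr (subst f w) :=
  subst_lift Sum.inr_injective Sum.inr_injective (fun _ => rfl) (fun _ => rfl) hf

theorem sum_mul_partialD_liftFst (u : ι₁ ⊕ κ₁ → Grassmann (κ₁ ⊕ κ₂))
    (v : ι₂ ⊕ κ₂ → Grassmann (κ₁ ⊕ κ₂)) {f : (ι₁ → ℝ) → Grassmann κ₁} {x : ι₁ ⊕ ι₂ → ℝ}
    (hf : ContDiffAt ℝ ∞ f (x ∘ Sum.inl)) :
    ∑ a, sumIndex u v a * partialD a (liftFst f) x =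
      ∑ a, u a * incl Sum.inl (partialD a f (x ∘ Sum.inl)) := by
  have h1 : ∀ a : ι₂, partialD (Sum.inl (Sum.inr a)) (liftFst (κ₂ := κ₂) f) x = 0 := fun a =>
    partialD_lift_inl_of_notMem _ hf (by simp)
  have h2 : ∀ a : κ₂, partialD (Sum.inr (Sum.inr a)) (liftFst f) x = 0 := fun a =>
    partialD_lift_inr_of_notMem _ _ _ (by simp)
  simp [Fintype.sum_sum_type, sumIndex, h1, h2, partialD_lift_inl Sum.inl_injective _ hf,
    partialD_lift_inr _ Sum.inl_injective]

theorem sum_mul_partialD_liftSnd (u : ι₁ ⊕ κ₁ → Grassmann (κ₁ ⊕ κ₂))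
    (v : ι₂ ⊕ κ₂ → Grassmann (κ₁ ⊕ κ₂)) {f : (ι₂ → ℝ) → Grassmann κ₂} {x : ι₁ ⊕ ι₂ → ℝ}
    (hf : ContDiffAt ℝ ∞ f (x ∘ Sum.inr)) :
    ∑ a, sumIndex u v a * partialD a (liftSnd f) x =
      ∑ a, v a * incl Sum.inr (partialD a f (x ∘ Sum.inr)) := by
  have h1 : ∀ a : ι₁, partialD (Sum.inl (Sum.inl a)) (liftSnd (κ₁ := κ₁) f) x = 0 := fun a =>
    partialD_lift_inl_of_notMem _ hf (by simp)
  have h2 : ∀ a : κ₁, partialD (Sum.inr (Sum.inl a)) (liftSnd f) x = 0 := fun a =>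
    partialD_lift_inr_of_notMem _ _ _ (by simp)
  simp [Fintype.sum_sum_type, sumIndex, h1, h2, partialD_lift_inl Sum.inr_injective _ hf,
    partialD_lift_inr _ Sum.inr_injective]

/-- The product of two charts. -/
def prodChart {X Y : Type*} [TopologicalSpace X] [TopologicalSpace Y]
    (e : OpenPartialHomeomorph X (ι₁ → ℝ)) (e' : OpenPartialHomeomorph Y (ι₂ → ℝ)) :
    OpenPartialHomeomorph (X × Y) (ι₁ ⊕ ι₂ → ℝ) :=
  (e.prod e').transHomeomorph Homeomorph.sumArrowHomeomorphProdArrow.symm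

theorem mem_prodChart_target {X Y : Type*} [TopologicalSpace X] [TopologicalSpace Y]
    {e : OpenPartialHomeomorph X (ι₁ → ℝ)} {e' : OpenPartialHomeomorph Y (ι₂ → ℝ)}
    {x : ι₁ ⊕ ι₂ → ℝ} :
    x ∈ (prodChart e e').target ↔ x ∘ Sum.inl ∈ e.target ∧ x ∘ Sum.inr ∈ e'.target := by
  rfl

theorem mem_prodChart_overlap {X Y : Type*} [TopologicalSpace X] [TopologicalSpace Y]
    {e e₂ : OpenPartialHomeomorph X (ι₁ → ℝ)} {e' e₂' : OpenPartialHomeomorph Y (ι₂ → ℝ)}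
    {x : ι₁ ⊕ ι₂ → ℝ} :
    x ∈ ((prodChart e e').symm.trans (prodChart e₂ e₂')).source ↔
      x ∘ Sum.inl ∈ (e.symm.trans e₂).source ∧ x ∘ Sum.inr ∈ (e'.symm.trans e₂').source := by
  simp only [OpenPartialHomeomorph.trans_source, OpenPartialHomeomorph.symm_source,
    Set.mem_inter_iff, mem_prodChart_target, Set.mem_preimage]
  have h : (prodChart e e').symm x ∈ (prodChart e₂ e₂').source ↔
      e.symm (x ∘ Sum.inl) ∈ e₂.source ∧ e'.symm (x ∘ Sum.inr) ∈ e₂'.source := Iff.rfl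
  rw [h]
  tauto

namespace Supermanifold

/-- The product of two supermanifolds: the coordinates on the product of two charts are the
coordinates of the two factors taken together. -/
abbrev prod (M₁ : Supermanifold ι₁ κ₁) (M₂ : Supermanifold ι₂ κ₂) :
    Supermanifold (ι₁ ⊕ ι₂) (κ₁ ⊕ κ₂) where
  carrier := M₁.carrier × M₂.carrier
  index := M₁.index × M₂.index
  chart := fun i => prodChart (M₁.chart i.1) (M₂.chart i.2)
  cover := fun p => by
    obtain ⟨i, hi⟩ := M₁.cover p.1
    obtain ⟨j, hj⟩ := M₂.cover p.2
    exact ⟨(i, j), hi, hj⟩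
  trans := fun i j x =>
    (M₁.trans i.1 j.1 (x ∘ Sum.inl)).prod (M₂.trans i.2 j.2 (x ∘ Sum.inr))
  smooth_trans := fun i j a x hx => by
    rw [mem_prodChart_overlap] at hx
    refine ContDiffAt.contDiffWithinAt ?_
    rcases a with (a | a) | (a | a)
    · exact contDiffAt_lift Sum.inl Sum.inl (M₁.contDiffAt_trans hx.1 (Sum.inl a))
    · exact contDiffAt_lift Sum.inr Sum.inr (M₂.contDiffAt_trans hx.2 (Sum.inl a))
    · exact contDiffAt_lift Sum.inl Sum.inl (M₁.contDiffAt_trans hx.1 (Sum.inr a))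
    · exact contDiffAt_lift Sum.inr Sum.inr (M₂.contDiffAt_trans hx.2 (Sum.inr a))
  base_trans := fun i j x hx => by
    rw [mem_prodChart_overlap] at hx
    rw [base_prod, M₁.base_trans _ _ _ hx.1, M₂.base_trans _ _ _ hx.2]
    rfl
  trans_self := fun i x hx => by
    rw [mem_prodChart_target] at hx
    rw [M₁.trans_self _ _ hx.1, M₂.trans_self _ _ hx.2, self_prod]
  cocycle := fun i j k x hx hx' a => by
    rw [mem_prodChart_overlap] at hx hx'
    have h1 := fun a => (subst_liftFst (M₁.trans i.1 j.1 (x ∘ Sum.inl))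
      (M₂.trans i.2 j.2 (x ∘ Sum.inr))
      (M₁.contDiffAt_trans (base_mem_overlap hx.1 hx'.1) a)).trans
      (congrArg _ (M₁.cocycle _ _ k.1 _ hx.1 hx'.1 a).symm)
    have h2 := fun a => (subst_liftSnd (M₁.trans i.1 j.1 (x ∘ Sum.inl))
      (M₂.trans i.2 j.2 (x ∘ Sum.inr))
      (M₂.contDiffAt_trans (base_mem_overlap hx.2 hx'.2) a)).trans
      (congrArg _ (M₂.cocycle _ _ k.2 _ hx.2 hx'.2 a).symm)
    rcases a with (a | a) | (a | a)
    · exact (h1 (Sum.inl a)).symm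
    · exact (h2 (Sum.inl a)).symm
    · exact (h1 (Sum.inr a)).symm
    · exact (h2 (Sum.inr a)).symm

theorem mem_prod_target {M₁ : Supermanifold ι₁ κ₁} {M₂ : Supermanifold ι₂ κ₂}
    {i : M₁.index} {j : M₂.index} {x : ι₁ ⊕ ι₂ → ℝ} :
    x ∈ ((M₁.prod M₂).chart (i, j)).target ↔
      x ∘ Sum.inl ∈ (M₁.chart i).target ∧ x ∘ Sum.inr ∈ (M₂.chart j).target := Iff.rfl

theorem mem_prod_overlap {M₁ : Supermanifold ι₁ κ₁} {M₂ : Supermanifold ι₂ κ₂}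
    {i i' : M₁.index} {j j' : M₂.index} {x : ι₁ ⊕ ι₂ → ℝ} :
    x ∈ (M₁.prod M₂).overlap (i, j) (i', j') ↔
      x ∘ Sum.inl ∈ M₁.overlap i i' ∧ x ∘ Sum.inr ∈ M₂.overlap j j' := mem_prodChart_overlap

/-- The sum `X₁ + X₂` of vector fields on the factors, as a vector field on the product. -/
def VectorField.prod {M₁ : Supermanifold ι₁ κ₁} {M₂ : Supermanifold ι₂ κ₂} {p : ZMod 2}
    (X₁ : M₁.VectorField p) (X₂ : M₂.VectorField p) : (M₁.prod M₂).VectorField p where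
  comp := fun i => sumIndex (fun a => liftFst (X₁.comp i.1 a)) (fun a => liftSnd (X₂.comp i.2 a))
  smooth_comp := fun i a x hx => by
    refine ContDiffAt.contDiffWithinAt ?_
    rcases a with (a | a) | (a | a)
    · exact contDiffAt_lift Sum.inl Sum.inl (X₁.contDiffAt_comp hx.1 (Sum.inl a))
    · exact contDiffAt_lift Sum.inr Sum.inr (X₂.contDiffAt_comp hx.2 (Sum.inl a))
    · exact contDiffAt_lift Sum.inl Sum.inl (X₁.contDiffAt_comp hx.1 (Sum.inr a))
    · exact contDiffAt_lift Sum.inr Sum.inr (X₂.contDiffAt_comp hx.2 (Sum.inr a))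
  parity_comp := fun i a x hx => by
    rcases a with (a | a) | (a | a)
    · exact incl_mem _ (X₁.parity_comp i.1 (Sum.inl a) _ hx.1)
    · exact incl_mem _ (X₂.parity_comp i.2 (Sum.inl a) _ hx.2)
    · exact incl_mem _ (X₁.parity_comp i.1 (Sum.inr a) _ hx.1)
    · exact incl_mem _ (X₂.parity_comp i.2 (Sum.inr a) _ hx.2)
  comp_trans := fun i j x hx b => by
    obtain ⟨i, i₂⟩ := i
    obtain ⟨j, j₂⟩ := j
    rw [mem_prod_overlap] at hx
    have hc : ∀ a, (fun y => sumIndex (fun a => liftFst (κ₂ := κ₂) (ι₂ := ι₂) (X₁.comp i a))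
        (fun a => liftSnd (X₂.comp i₂ a)) a y) = sumIndex
          (fun a => liftFst (κ₂ := κ₂) (ι₂ := ι₂) (X₁.comp i a))
          (fun a => liftSnd (X₂.comp i₂ a)) a := fun _ => rfl
    have hs : ∀ a, sumIndex (fun a => liftFst (κ₂ := κ₂) (ι₂ := ι₂) (X₁.comp i a))
        (fun a => liftSnd (X₂.comp i₂ a)) a x = sumIndex
          (fun a => incl Sum.inl (X₁.comp i a (x ∘ Sum.inl)))
          (fun a => incl Sum.inr (X₂.comp i₂ a (x ∘ Sum.inr))) a := by
      rintro ((a | a) | (a | a)) <;> rfl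
    have h1 : ∀ b, subst (liftFst (X₁.comp j b))
        ((M₁.trans i j (x ∘ Sum.inl)).prod (M₂.trans i₂ j₂ (x ∘ Sum.inr))) =
        ∑ a, sumIndex (fun a => liftFst (κ₂ := κ₂) (ι₂ := ι₂) (X₁.comp i a))
          (fun a => liftSnd (X₂.comp i₂ a)) a x *
          partialD a (liftFst fun y => (M₁.trans i j y).coord b) x := by
      intro b
      rw [subst_liftFst _ _ (X₁.contDiffAt_comp (base_mem_target hx.1) b),
        X₁.comp_trans i j _ hx.1 b, map_sum]
      simp only [hs]
      rw [sum_mul_partialD_liftFst _ _ (M₁.contDiffAt_trans hx.1 b)]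
      simp
    have h2 : ∀ b, subst (liftSnd (X₂.comp j₂ b))
        ((M₁.trans i j (x ∘ Sum.inl)).prod (M₂.trans i₂ j₂ (x ∘ Sum.inr))) =
        ∑ a, sumIndex (fun a => liftFst (κ₂ := κ₂) (ι₂ := ι₂) (X₁.comp i a))
          (fun a => liftSnd (X₂.comp i₂ a)) a x *
          partialD a (liftSnd fun y => (M₂.trans i₂ j₂ y).coord b) x := by
      intro b
      rw [subst_liftSnd _ _ (X₂.contDiffAt_comp (base_mem_target hx.2) b),
        X₂.comp_trans i₂ j₂ _ hx.2 b, map_sum]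
      simp only [hs]
      rw [sum_mul_partialD_liftSnd _ _ (M₂.contDiffAt_trans hx.2 b)]
      simp
    rcases b with (b | b) | (b | b)
    · exact h1 (Sum.inl b)
    · exact h2 (Sum.inl b)
    · exact h1 (Sum.inr b)
    · exact h2 (Sum.inr b)

theorem VectorField.act_prod_liftFst {M₁ : Supermanifold ι₁ κ₁} {M₂ : Supermanifold ι₂ κ₂}
    {p : ZMod 2} (X₁ : M₁.VectorField p) (X₂ : M₂.VectorField p) (i : (M₁.prod M₂).index)
    {f : (ι₁ → ℝ) → Grassmann κ₁} {x : ι₁ ⊕ ι₂ → ℝ} (hf : ContDiffAt ℝ ∞ f (x ∘ Sum.inl)) :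
    (X₁.prod X₂).act i (liftFst f) x = liftFst (X₁.act i.1 f) x := by
  have hs : ∀ a, (X₁.prod X₂).comp i a x = sumIndex
      (fun a => incl Sum.inl (X₁.comp i.1 a (x ∘ Sum.inl)))
      (fun a => incl Sum.inr (X₂.comp i.2 a (x ∘ Sum.inr))) a := by
    rintro ((a | a) | (a | a)) <;> rfl
  simp only [VectorField.act, hs]
  rw [sum_mul_partialD_liftFst _ _ hf]
  simp [lift, VectorField.act]

theorem VectorField.act_prod_liftSnd {M₁ : Supermanifold ι₁ κ₁} {M₂ : Supermanifold ι₂ κ₂}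
    {p : ZMod 2} (X₁ : M₁.VectorField p) (X₂ : M₂.VectorField p) (i : (M₁.prod M₂).index)
    {f : (ι₂ → ℝ) → Grassmann κ₂} {x : ι₁ ⊕ ι₂ → ℝ} (hf : ContDiffAt ℝ ∞ f (x ∘ Sum.inr)) :
    (X₁.prod X₂).act i (liftSnd f) x = liftSnd (X₂.act i.2 f) x := by
  have hs : ∀ a, (X₁.prod X₂).comp i a x = sumIndex
      (fun a => incl Sum.inl (X₁.comp i.1 a (x ∘ Sum.inl)))
      (fun a => incl Sum.inr (X₂.comp i.2 a (x ∘ Sum.inr))) a := by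
    rintro ((a | a) | (a | a)) <;> rfl
  simp only [VectorField.act, hs]
  rw [sum_mul_partialD_liftSnd _ _ hf]
  simp [lift, VectorField.act]

/-- The pullback of functions along the projection `M₁ × M₂ → M₁`. -/
def pullFst (M₁ : Supermanifold ι₁ κ₁) (M₂ : Supermanifold ι₂ κ₂) :
    (M₁.index → (ι₁ → ℝ) → Grassmann κ₁) →ₗ[ℝ]
      ((M₁.prod M₂).index → (ι₁ ⊕ ι₂ → ℝ) → Grassmann (κ₁ ⊕ κ₂)) where
  toFun f i := Set.indicator ((M₁.prod M₂).chart i).target (liftFst (f i.1))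
  map_add' f g := by
    funext i x
    by_cases hx : x ∈ ((M₁.prod M₂).chart i).target <;> simp [Set.indicator, hx, lift]
  map_smul' c f := by
    funext i x
    by_cases hx : x ∈ ((M₁.prod M₂).chart i).target <;> simp [Set.indicator, hx, lift]

/-- The pullback of functions along the projection `M₁ × M₂ → M₂`. -/
def pullSnd (M₁ : Supermanifold ι₁ κ₁) (M₂ : Supermanifold ι₂ κ₂) :
    (M₂.index → (ι₂ → ℝ) → Grassmann κ₂) →ₗ[ℝ]
      ((M₁.prod M₂).index → (ι₁ ⊕ ι₂ → ℝ) → Grassmann (κ₁ ⊕ κ₂)) where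
  toFun f i := Set.indicator ((M₁.prod M₂).chart i).target (liftSnd (f i.2))
  map_add' f g := by
    funext i x
    by_cases hx : x ∈ ((M₁.prod M₂).chart i).target <;> simp [Set.indicator, hx, lift]
  map_smul' c f := by
    funext i x
    by_cases hx : x ∈ ((M₁.prod M₂).chart i).target <;> simp [Set.indicator, hx, lift]

theorem pullFst_eventuallyEq (M₁ : Supermanifold ι₁ κ₁) (M₂ : Supermanifold ι₂ κ₂)
    (f : M₁.index → (ι₁ → ℝ) → Grassmann κ₁) {i : (M₁.prod M₂).index} {x : ι₁ ⊕ ι₂ → ℝ}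
    (hx : x ∈ ((M₁.prod M₂).chart i).target) :
    pullFst M₁ M₂ f i =ᶠ[nhds x] liftFst (f i.1) := by
  filter_upwards [((M₁.prod M₂).chart i).open_target.mem_nhds hx] with y hy
  exact Set.indicator_of_mem hy _

theorem pullSnd_eventuallyEq (M₁ : Supermanifold ι₁ κ₁) (M₂ : Supermanifold ι₂ κ₂)
    (f : M₂.index → (ι₂ → ℝ) → Grassmann κ₂) {i : (M₁.prod M₂).index} {x : ι₁ ⊕ ι₂ → ℝ}
    (hx : x ∈ ((M₁.prod M₂).chart i).target) :
    pullSnd M₁ M₂ f i =ᶠ[nhds x] liftSnd (f i.2) := by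
  filter_upwards [((M₁.prod M₂).chart i).open_target.mem_nhds hx] with y hy
  exact Set.indicator_of_mem hy _

theorem pullFst_mem (M₁ : Supermanifold ι₁ κ₁) (M₂ : Supermanifold ι₂ κ₂)
    {f : M₁.index → (ι₁ → ℝ) → Grassmann κ₁} (hf : f ∈ M₁.functions) :
    pullFst M₁ M₂ f ∈ (M₁.prod M₂).functions := by
  refine ⟨fun i x hx => ?_, fun i x hx => Set.indicator_of_notMem hx _, fun i j x hx => ?_⟩
  · refine ContDiffAt.contDiffWithinAt ?_
    exact (contDiffAt_lift Sum.inl Sum.inl (contDiffAt_of_mem hf (mem_prod_target.mp hx).1)).congr_of_eventuallyEq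
      (pullFst_eventuallyEq M₁ M₂ f hx)
  · rw [subst_congr (pullFst_eventuallyEq M₁ M₂ f (base_mem_target hx)),
      (pullFst_eventuallyEq M₁ M₂ f (mem_overlap.mp hx).1).eq_of_nhds]
    obtain ⟨h1, -⟩ := mem_prod_overlap.mp hx
    have h := subst_liftFst (M₁.trans i.1 j.1 (x ∘ Sum.inl)) (M₂.trans i.2 j.2 (x ∘ Sum.inr))
      (contDiffAt_of_mem hf (base_mem_target h1))
    rw [← hf.2.2 _ _ _ h1] at h
    exact h.symm

theorem pullSnd_mem (M₁ : Supermanifold ι₁ κ₁) (M₂ : Supermanifold ι₂ κ₂)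
    {f : M₂.index → (ι₂ → ℝ) → Grassmann κ₂} (hf : f ∈ M₂.functions) :
    pullSnd M₁ M₂ f ∈ (M₁.prod M₂).functions := by
  refine ⟨fun i x hx => ?_, fun i x hx => Set.indicator_of_notMem hx _, fun i j x hx => ?_⟩
  · refine ContDiffAt.contDiffWithinAt ?_
    exact (contDiffAt_lift Sum.inr Sum.inr (contDiffAt_of_mem hf (mem_prod_target.mp hx).2)).congr_of_eventuallyEq
      (pullSnd_eventuallyEq M₁ M₂ f hx)
  · rw [subst_congr (pullSnd_eventuallyEq M₁ M₂ f (base_mem_target hx)),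
      (pullSnd_eventuallyEq M₁ M₂ f (mem_overlap.mp hx).1).eq_of_nhds]
    obtain ⟨-, h2⟩ := mem_prod_overlap.mp hx
    have h := subst_liftSnd (M₁.trans i.1 j.1 (x ∘ Sum.inl)) (M₂.trans i.2 j.2 (x ∘ Sum.inr))
      (contDiffAt_of_mem hf (base_mem_target h2))
    rw [← hf.2.2 _ _ _ h2] at h
    exact h.symm

theorem VectorField.act_congr {M : Supermanifold ι₁ κ₁} {p : ZMod 2} (X : M.VectorField p)
    (i : M.index) {f g : (ι₁ → ℝ) → Grassmann κ₁} {x : ι₁ → ℝ} (h : f =ᶠ[nhds x] g) :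
    X.act i f x = X.act i g x := by
  simp only [VectorField.act, partialD_congr _ h]

end Supermanifold

namespace QManifold

/-- The Q-manifold product `(M₁ × M₂, Q₁ + Q₂)`. -/
abbrev prod (M₁ : QManifold ι₁ κ₁) (M₂ : QManifold ι₂ κ₂) : QManifold (ι₁ ⊕ ι₂) (κ₁ ⊕ κ₂) where
  toSupermanifold := M₁.toSupermanifold.prod M₂.toSupermanifold
  Q := M₁.Q.prod M₂.Q
  Q_sq := fun i x hx b => by
    have h1 : ∀ b, (M₁.Q.prod M₂.Q).act i (liftFst (M₁.Q.comp i.1 b)) x = 0 := fun b => by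
      rw [Supermanifold.VectorField.act_prod_liftFst _ _ _ (M₁.Q.contDiffAt_comp (Supermanifold.mem_prod_target.mp hx).1 b)]
      change incl Sum.inl _ = 0
      rw [M₁.Q_sq _ _ (Supermanifold.mem_prod_target.mp hx).1, map_zero]
    have h2 : ∀ b, (M₁.Q.prod M₂.Q).act i (liftSnd (M₂.Q.comp i.2 b)) x = 0 := fun b => by
      rw [Supermanifold.VectorField.act_prod_liftSnd _ _ _ (M₂.Q.contDiffAt_comp (Supermanifold.mem_prod_target.mp hx).2 b)]
      change incl Sum.inr _ = 0
      rw [M₂.Q_sq _ _ (Supermanifold.mem_prod_target.mp hx).2, map_zero]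
    rcases b with (b | b) | (b | b)
    · exact h1 (Sum.inl b)
    · exact h2 (Sum.inl b)
    · exact h1 (Sum.inr b)
    · exact h2 (Sum.inr b)

variable (M₁ : QManifold ι₁ κ₁) (M₂ : QManifold ι₂ κ₂)

theorem act_pullFst {f : M₁.index → (ι₁ → ℝ) → Grassmann κ₁} (hf : f ∈ M₁.functions)
    {i : (M₁.prod M₂).index} {x : ι₁ ⊕ ι₂ → ℝ} (hx : x ∈ ((M₁.prod M₂).chart i).target) :
    (M₁.prod M₂).Q.act i (Supermanifold.pullFst _ M₂.toSupermanifold f i) x =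
      incl Sum.inl (M₁.Q.act i.1 (f i.1) (x ∘ Sum.inl)) := by
  rw [Supermanifold.VectorField.act_congr _ _ (Supermanifold.pullFst_eventuallyEq _ _ f hx)]
  exact Supermanifold.VectorField.act_prod_liftFst _ _ _
    (Supermanifold.contDiffAt_of_mem hf (Supermanifold.mem_prod_target.mp hx).1)

theorem act_pullSnd {f : M₂.index → (ι₂ → ℝ) → Grassmann κ₂} (hf : f ∈ M₂.functions)
    {i : (M₁.prod M₂).index} {x : ι₁ ⊕ ι₂ → ℝ} (hx : x ∈ ((M₁.prod M₂).chart i).target) :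
    (M₁.prod M₂).Q.act i (Supermanifold.pullSnd M₁.toSupermanifold _ f i) x =
      incl Sum.inr (M₂.Q.act i.2 (f i.2) (x ∘ Sum.inr)) := by
  rw [Supermanifold.VectorField.act_congr _ _ (Supermanifold.pullSnd_eventuallyEq _ _ f hx)]
  exact Supermanifold.VectorField.act_prod_liftSnd _ _ _
    (Supermanifold.contDiffAt_of_mem hf (Supermanifold.mem_prod_target.mp hx).2)

/-- The pullback of cocycles along `M₁ × M₂ → M₁`. -/
def pullFstCocycles : M₁.cocycles →ₗ[ℝ] (M₁.prod M₂).cocycles :=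
  (Supermanifold.pullFst M₁.toSupermanifold M₂.toSupermanifold).restrict fun f hf =>
    ⟨Supermanifold.pullFst_mem _ _ hf.1, fun i x hx => by
      rw [act_pullFst M₁ M₂ hf.1 hx, hf.2 _ _ (Supermanifold.mem_prod_target.mp hx).1, map_zero]⟩

/-- The pullback of cocycles along `M₁ × M₂ → M₂`. -/
def pullSndCocycles : M₂.cocycles →ₗ[ℝ] (M₁.prod M₂).cocycles :=
  (Supermanifold.pullSnd M₁.toSupermanifold M₂.toSupermanifold).restrict fun f hf =>
    ⟨Supermanifold.pullSnd_mem _ _ hf.1, fun i x hx => by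
      rw [act_pullSnd M₁ M₂ hf.1 hx, hf.2 _ _ (Supermanifold.mem_prod_target.mp hx).2, map_zero]⟩

/-- The map of standard cohomology induced by the projection `M₁ × M₂ → M₁`. -/
def cohomologyFst : M₁.Cohomology →ₗ[ℝ] (M₁.prod M₂).Cohomology :=
  Submodule.mapQ _ _ (pullFstCocycles M₁ M₂) fun f ⟨hf, g, hg, h⟩ =>
    ⟨Supermanifold.pullFst_mem _ _ hf, _, Supermanifold.pullFst_mem _ _ hg, fun i x hx => by
      rw [act_pullFst M₁ M₂ hg hx, ← h _ _ (Supermanifold.mem_prod_target.mp hx).1]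
      exact Set.indicator_of_mem hx _⟩

/-- The map of standard cohomology induced by the projection `M₁ × M₂ → M₂`. -/
def cohomologySnd : M₂.Cohomology →ₗ[ℝ] (M₁.prod M₂).Cohomology :=
  Submodule.mapQ _ _ (pullSndCocycles M₁ M₂) fun f ⟨hf, g, hg, h⟩ =>
    ⟨Supermanifold.pullSnd_mem _ _ hf, _, Supermanifold.pullSnd_mem _ _ hg, fun i x hx => by
      rw [act_pullSnd M₁ M₂ hg hx, ← h _ _ (Supermanifold.mem_prod_target.mp hx).2]
      exact Set.indicator_of_mem hx _⟩

end QManifold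

end

end Super

end

noncomputable section

namespace Super

/-! ### Parity and multiplication in Grassmann algebras -/

section
variable {κ μ : Type}

/-! Both halves of the statement rest on the behaviour of `log ρ`.

Uniqueness. In a chart the equation `ρ d = L_Q ρ` can be divided by the invertible even density,
which gives `d = ∂Qᵃ/∂xᵃ + Q(log ρ)` (`IsDivergence.eq_add`). The first term depends on the chart
but not on `ρ`, so two divergences differ by `Q(log ρ - log ρ')`. It remains to see that `log ρ -
log ρ'` is a global function. Under a change of charts `log ρ` picks up the summand `log Ber`, the
same for every volume, and this cancels in the difference (`log_density_trans`, `logRatio_mem`).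
Since `Real.log` is the logarithm of the absolute value, the signs of the densities and Berezinians
do not matter, and no orientation is needed.

The analytic work is to justify these manipulations for Grassmann valued functions. The logarithm is
the real logarithm of the body plus a terminating power series in the nilpotent part. It satisfies
`f ∂(log f) = ∂f` for even and odd derivatives (`partialD_log`), it turns products of even
invertible elements into sums (`log_mul`), and it commutes with substitution (`subst_log`). For the
last fact, as for the multiplicativity of substitution (`subst_mul`), the terminating Taylor formula
that defines `subst` is read as the time-one flow of the nilpotent derivation `∑ soul(zᵃ) ∂/∂xᵃ`.
The exponential of a nilpotent derivation is multiplicative, and identities for the logarithm follow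
by comparing derivatives in the time parameter.

Existence and the formula. If `ρ₁`, `ρ₂` are volumes on the factors, their product is a volume on
`M₁ × M₂`: the Jacobian is block diagonal, so its Berezinian is the product of the two Berezinians
(`berezinian_blockSum`). Each `Q_k` differentiates only the functions of its own factor, so by the
Leibniz rule the divergence of `Q₁ + Q₂` is the sum of the pulled back divergences
(`IsDivergence.prod`). -/

theorem exists_even_add_odd (x : Grassmann κ) :
    ∃ y ∈ parityPart κ 0, ∃ z ∈ parityPart κ 1, y + z = x := by
  have h : x ∈ parityPart κ 0 ⊔ parityPart κ 1 := by
    rw [(CliffordAlgebra.evenOdd_isCompl (0 : QuadraticForm ℝ (κ → ℝ))).sup_eq_top]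
    trivial
  exact Submodule.mem_sup.mp h

/-- Even elements are central. -/
theorem even_mul_comm {x : Grassmann κ} (hx : x ∈ parityPart κ 0) (y : Grassmann κ) :
    x * y = y * x := by
  obtain ⟨a, ha, b, hb, rfl⟩ := exists_even_add_odd y
  have h1 := mul_eq_of_mem hx ha
  have h2 := mul_eq_of_mem hx hb
  simp only [mul_zero, uzpow_zero, one_smul] at h1 h2
  rw [mul_add, add_mul, h1, h2]

theorem one_mem_even : (1 : Grassmann κ) ∈ parityPart κ 0 := (evenPart κ).one_mem

theorem mul_mem_even {x y : Grassmann κ} (hx : x ∈ parityPart κ 0) (hy : y ∈ parityPart κ 0) :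
    x * y ∈ parityPart κ 0 := (evenPart κ).mul_mem hx hy

theorem algebraMap_mem_even (r : ℝ) : algebraMap ℝ (Grassmann κ) r ∈ parityPart κ 0 :=
  (evenPart κ).algebraMap_mem r

theorem pow_mem_even {x : Grassmann κ} (hx : x ∈ parityPart κ 0) (n : ℕ) :
    x ^ n ∈ parityPart κ 0 := (evenPart κ).pow_mem hx n

/-- The sign of this graded Leibniz rule is the grading involution of the left factor. It is
obtained by splitting off one generator of that factor at a time. -/
theorem contractLeft_mul (d : Module.Dual ℝ (κ → ℝ)) (x y : Grassmann κ) :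
    CliffordAlgebra.contractLeft d (x * y) =
      CliffordAlgebra.contractLeft d x * y +
        CliffordAlgebra.involute x * CliffordAlgebra.contractLeft d y := by
  induction x using CliffordAlgebra.left_induction with
  | algebraMap r =>
    rw [CliffordAlgebra.contractLeft_algebraMap_mul, CliffordAlgebra.contractLeft_algebraMap,
      AlgHom.commutes, zero_mul, zero_add]
  | add x z hx hz => simp only [map_add, add_mul, hx, hz]; abel
  | ι_mul x v hx =>
    rw [mul_assoc, CliffordAlgebra.contractLeft_ι_mul, hx, CliffordAlgebra.contractLeft_ι_mul,
      map_mul, CliffordAlgebra.involute_ι]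
    simp only [mul_add, sub_mul, neg_mul, mul_assoc, smul_mul_assoc]
    abel

/-- The grading involution fixes even elements, so no sign appears. This is why odd and even
derivatives of densities can be treated alike below. -/
theorem contractLeft_even_mul (d : Module.Dual ℝ (κ → ℝ)) {x : Grassmann κ}
    (hx : x ∈ parityPart κ 0) (y : Grassmann κ) :
    CliffordAlgebra.contractLeft d (x * y) =
      CliffordAlgebra.contractLeft d x * y + x * CliffordAlgebra.contractLeft d y := by
  rw [contractLeft_mul, CliffordAlgebra.involute_eq_of_mem_even hx]

/-! ### Body, nilpotency and invertibility. -/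

theorem body_of_mem_odd {x : Grassmann κ} (hx : x ∈ parityPart κ 1) : body x = 0 := by
  have h := congrArg body (odd_mul_self hx)
  simpa using h

theorem body_ne_zero_of_isUnit {x : Grassmann κ} (hx : IsUnit x) : body x ≠ 0 :=
  (hx.map body).ne_zero

theorem pow_mem_degGE {x : Grassmann κ} (hx : body x = 0) (n : ℕ) : x ^ n ∈ degGE κ n := by
  induction n with
  | zero =>
    have h : (1 : Submodule ℝ (Grassmann κ)) ≤ degGE κ 0 := by
      rw [← pow_zero (LinearMap.range (ExteriorAlgebra.ι ℝ (M := κ → ℝ)))]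
      exact le_iSup (fun j : {j : ℕ // 0 ≤ j} =>
        LinearMap.range (ExteriorAlgebra.ι ℝ (M := κ → ℝ)) ^ (j : ℕ)) ⟨0, le_rfl⟩
    simpa using h (Submodule.one_le.mp le_rfl)
  | succ n ih =>
    rw [pow_succ]
    exact degGE_mul κ n 1 (Submodule.mul_mem_mul ih (mem_degGE_one hx))

theorem pow_eq_zero_of_body [Fintype κ] {x : Grassmann κ} (hx : body x = 0) :
    x ^ (Fintype.card κ + 1) = 0 := by
  have h := pow_mem_degGE hx (Fintype.card κ + 1)
  rwa [degGE_eq_bot κ _ (Nat.lt_succ_self _), Submodule.mem_bot] at h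

/-- After division by its body, `x` differs from `1` by an element of body zero, which is nilpotent.
-/
theorem isUnit_of_body_ne_zero [Fintype κ] {x : Grassmann κ} (hx : body x ≠ 0) : IsUnit x := by
  have h1 : IsNilpotent (1 - (body x)⁻¹ • x) := ⟨_, pow_eq_zero_of_body (by simp [hx])⟩
  have h2 : IsUnit ((body x)⁻¹ • x) := by simpa using h1.isUnit_one_sub
  have h3 := h2.smul (Units.mk0 _ hx)
  rwa [Units.smul_def, Units.val_mk0, smul_smul, mul_inv_cancel₀ hx, one_smul] at h3

/-- Two algebra morphisms to `ℝ` are compared on the generators, where both vanish: the values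
substituted for them are odd and so have body zero. -/
theorem body_oddSubst {ι : Type} [Fintype κ] (z : Point ι κ μ) (x : Grassmann κ) :
    body (z.oddSubst x) = body x := by
  have h : (body.comp z.oddSubst : Grassmann κ →ₐ[ℝ] ℝ) = body := by
    refine ExteriorAlgebra.hom_ext (LinearMap.ext fun v => ?_)
    simp [body, Point.oddSubst, ExteriorAlgebra.algebraMapInv, Fintype.linearCombination_apply]
    refine Finset.sum_eq_zero fun k _ => ?_
    have := body_of_mem_odd (z.odd k).2
    simp only [body, ExteriorAlgebra.algebraMapInv] at this
    simp [this]
  exact DFunLike.congr_fun h x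

theorem oddSubst_mem {ι : Type} [Fintype κ] (z : Point ι κ μ) {p : ZMod 2} {x : Grassmann κ}
    (hx : x ∈ parityPart κ p) : z.oddSubst x ∈ parityPart μ p := by
  -- Generators go to odd elements, so a product of `n` generators goes to a product of `n` odd
  -- elements, whose parity is `n` modulo 2.
  have h1 : ∀ n : ℕ, (parityPart μ 1) ^ n ≤ parityPart μ n := by
    intro n
    induction n with
    | zero => rw [pow_zero, Submodule.one_le]; simpa using one_mem_even
    | succ n ih =>
      rw [pow_succ, Nat.cast_succ]
      exact (mul_le_mul' ih le_rfl).trans (CliffordAlgebra.evenOdd_mul_le _ _ _)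
  have h : parityPart κ p ≤ (parityPart μ p).comap z.oddSubst.toLinearMap := by
    refine iSup_le fun j => ?_
    obtain ⟨j, rfl⟩ := j
    rw [← Submodule.map_le_iff_le_comap, Submodule.map_pow]
    refine (pow_le_pow_left' ?_ _).trans (h1 j)
    rintro _ ⟨_, ⟨v, rfl⟩, rfl⟩
    have : z.oddSubst (ExteriorAlgebra.ι ℝ v) ∈ parityPart μ 1 := by
      rw [Point.oddSubst, ExteriorAlgebra.lift_ι_apply, Fintype.linearCombination_apply]
      exact Submodule.sum_mem _ fun k _ => Submodule.smul_mem _ _ (z.odd k).2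
    exact this
  exact h hx

end

/-! ### Calculus of Grassmann valued functions -/

section
variable {κ : Type} [Fintype κ] {E : Type*} [NormedAddCommGroup E] [NormedSpace ℝ E]

/-- Multiplication as a continuous bilinear map. -/
def mulCLM (κ : Type) [Finite κ] : Grassmann κ →L[ℝ] Grassmann κ →L[ℝ] Grassmann κ :=
  (LinearMap.mul ℝ (Grassmann κ)).toContinuousBilinearMap

/-- The body as a continuous linear map. -/
def bodyCLM (κ : Type) [Finite κ] : Grassmann κ →L[ℝ] ℝ :=
  LinearMap.toContinuousLinearMap (body (κ := κ)).toLinearMap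

theorem contDiffAt_mul {f g : E → Grassmann κ} {x : E} {n : WithTop ℕ∞}
    (hf : ContDiffAt ℝ n f x) (hg : ContDiffAt ℝ n g x) :
    ContDiffAt ℝ n (fun y => f y * g y) x :=
  ((mulCLM κ).contDiff.contDiffAt.comp x hf).clm_apply hg

theorem contDiffOn_mul {f g : E → Grassmann κ} {s : Set E} {n : WithTop ℕ∞}
    (hf : ContDiffOn ℝ n f s) (hg : ContDiffOn ℝ n g s) :
    ContDiffOn ℝ n (fun y => f y * g y) s :=
  ((mulCLM κ).contDiff.comp_contDiffOn hf).clm_apply hg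

theorem hasFDerivAt_mul {f g : E → Grassmann κ} {f' g' : E →L[ℝ] Grassmann κ} {x : E}
    (hf : HasFDerivAt f f' x) (hg : HasFDerivAt g g' x) :
    HasFDerivAt (fun y => f y * g y)
      ((mulCLM κ).precompR E (f x) g' + (mulCLM κ).precompL E f' (g x)) x :=
  (mulCLM κ).hasFDerivAt_of_bilinear hf hg

theorem fderiv_mul_apply {f g : E → Grassmann κ} {x : E}
    (hf : DifferentiableAt ℝ f x) (hg : DifferentiableAt ℝ g x) (v : E) :
    fderiv ℝ (fun y => f y * g y) x v = f x * fderiv ℝ g x v + fderiv ℝ f x v * g x := by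
  rw [(hasFDerivAt_mul hf.hasFDerivAt hg.hasFDerivAt).fderiv]
  rfl

theorem hasDerivAt_mul {f g : ℝ → Grassmann κ} {f' g' : Grassmann κ} {t : ℝ}
    (hf : HasDerivAt f f' t) (hg : HasDerivAt g g' t) :
    HasDerivAt (fun s => f s * g s) (f t * g' + f' * g t) t := by
  have h := (hasFDerivAt_mul hf.hasFDerivAt hg.hasFDerivAt).hasDerivAt
  simpa [mulCLM] using h

theorem partialD_mul {ι : Type} [Fintype ι] [DecidableEq ι] (a : ι ⊕ κ)
    {f g : (ι → ℝ) → Grassmann κ} {x : ι → ℝ} (hf : DifferentiableAt ℝ f x)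
    (hg : DifferentiableAt ℝ g x) (he : f x ∈ parityPart κ 0) :
    partialD a (fun y => f y * g y) x = partialD a f x * g x + f x * partialD a g x := by
  rcases a with a | k
  · exact (fderiv_mul_apply hf hg _).trans (add_comm _ _)
  · exact contractLeft_even_mul _ he _

/-- The difference quotients lie in `S`, and a finite-dimensional subspace is closed. Without
differentiability `fderiv` is zero by convention. -/
theorem fderiv_mem {f : E → Grassmann κ} {x : E} {S : Submodule ℝ (Grassmann κ)}
    (h : ∀ᶠ y in nhds x, f y ∈ S) (v : E) : fderiv ℝ f x v ∈ S := by
  by_cases hf : DifferentiableAt ℝ f x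
  · have hl := (hf.hasFDerivAt.hasLineDerivAt v).tendsto_slope_zero
    have : Filter.Tendsto (fun t : ℝ => x + t • v) (nhds 0) (nhds x) := by
      have hc : Continuous (fun t : ℝ => x + t • v) := by fun_prop
      simpa using hc.tendsto 0
    refine (Submodule.closed_of_finiteDimensional S).mem_of_tendsto hl ?_
    filter_upwards [(this.eventually h).filter_mono nhdsWithin_le_nhds] with t ht
    simpa using S.smul_mem _ (S.sub_mem ht h.self_of_nhds)
  · simp [fderiv_zero_of_not_differentiableAt hf]

end

/-! ### Substitution as the exponential of a nilpotent derivation -/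

section
variable {ι κ μ : Type} [Fintype ι] [DecidableEq ι] [Fintype κ] [Fintype μ]

/-- The algebra of smooth Grassmann valued functions on `U`, extended by zero. -/
def smoothOn (μ : Type) [Fintype μ] (U : Set (ι → ℝ)) :
    NonUnitalSubalgebra ℝ ((ι → ℝ) → Grassmann μ) where
  -- Vanishing off `U` makes equality in this algebra the same as equality on `U`, so that
  -- differentiation on `U` becomes an endomorphism whose powers and exponential can be formed.
  carrier := {F | ContDiffOn ℝ ∞ F U ∧ ∀ x ∉ U, F x = 0}
  add_mem' := fun {F G} hF hG => ⟨hF.1.add hG.1, fun x hx => by simp [hF.2 x hx, hG.2 x hx]⟩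
  zero_mem' := ⟨contDiffOn_const, fun _ _ => rfl⟩
  mul_mem' := fun {F G} hF hG => ⟨contDiffOn_mul hF.1 hG.1, fun x hx => by simp [hF.2 x hx]⟩
  smul_mem' := fun c F hF => ⟨hF.1.const_smul c, fun x hx => by simp [hF.2 x hx]⟩

variable {U : Set (ι → ℝ)}

theorem smoothOn.contDiffAt (hU : IsOpen U) (F : smoothOn μ U) {x : ι → ℝ} (hx : x ∈ U) :
    ContDiffAt ℝ ∞ F.1 x := F.2.1.contDiffAt (hU.mem_nhds hx)

theorem smoothOn.differentiableAt (hU : IsOpen U) (F : smoothOn μ U) {x : ι → ℝ} (hx : x ∈ U) :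
    DifferentiableAt ℝ F.1 x := (smoothOn.contDiffAt hU F hx).differentiableAt (by simp)

/-- Extension by zero of a function that is smooth on `U`. -/
def smoothOn.mk {f : (ι → ℝ) → Grassmann μ} (hf : ContDiffOn ℝ ∞ f U) : smoothOn μ U :=
  ⟨U.indicator f, hf.congr fun _ hx => Set.indicator_of_mem hx f,
    fun _ hx => Set.indicator_of_notMem hx f⟩

theorem smoothOn.mk_apply {f : (ι → ℝ) → Grassmann μ} (hf : ContDiffOn ℝ ∞ f U) {x : ι → ℝ}
    (hx : x ∈ U) : (smoothOn.mk hf).1 x = f x := Set.indicator_of_mem hx f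

theorem smoothOn.mk_eventuallyEq (hU : IsOpen U) {f : (ι → ℝ) → Grassmann μ}
    (hf : ContDiffOn ℝ ∞ f U) {x : ι → ℝ} (hx : x ∈ U) : (smoothOn.mk hf).1 =ᶠ[nhds x] f := by
  filter_upwards [hU.mem_nhds hx] with y hy
  exact smoothOn.mk_apply hf hy

/-- The derivation `∑ sᵃ ∂/∂xᵃ` with constant even nilpotent coefficients. -/
def soulDeriv (hU : IsOpen U) (s : ι → evenPart μ) : Module.End ℝ (smoothOn μ U) where
  toFun F := ⟨U.indicator fun x => ∑ a, fderiv ℝ F.1 x (Pi.single a 1) * (soul (s a)).1, by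
    refine ⟨ContDiffOn.congr (f := fun x => ∑ a, fderiv ℝ F.1 x (Pi.single a 1) *
      (soul (s a)).1) ?_ fun x hx => Set.indicator_of_mem hx _,
      fun x hx => Set.indicator_of_notMem hx _⟩
    refine ContDiffOn.sum fun a _ => contDiffOn_mul ?_ contDiffOn_const
    exact (F.2.1.fderiv_of_isOpen hU (by simp)).clm_apply contDiffOn_const⟩
  map_add' F G := by
    refine Subtype.ext (funext fun x => ?_)
    by_cases hx : x ∈ U
    · simp [hx, fderiv_add (smoothOn.differentiableAt hU F hx) (smoothOn.differentiableAt hU G hx), add_mul,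
        Finset.sum_add_distrib]
    · simp [hx]
  map_smul' c F := by
    refine Subtype.ext (funext fun x => ?_)
    by_cases hx : x ∈ U
    · simp [hx, fderiv_const_smul (smoothOn.differentiableAt hU F hx), Finset.smul_sum]
    · simp [hx]

theorem soulDeriv_apply (hU : IsOpen U) (s : ι → evenPart μ) (F : smoothOn μ U) {x : ι → ℝ}
    (hx : x ∈ U) : (soulDeriv hU s F).1 x =
      ∑ a, fderiv ℝ F.1 x (Pi.single a 1) * (soul (s a)).1 :=
  Set.indicator_of_mem hx fun x => ∑ a, fderiv ℝ F.1 x (Pi.single a 1) * (soul (s a)).1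

/-- The Leibniz rule of each partial derivative survives because the coefficients are even, hence
central, and can be moved past `G`. -/
theorem soulDeriv_mul (hU : IsOpen U) (s : ι → evenPart μ) (F G : smoothOn μ U) :
    soulDeriv hU s (F * G) = F * soulDeriv hU s G + soulDeriv hU s F * G := by
  refine Subtype.ext (funext fun x => ?_)
  by_cases hx : x ∈ U
  · have h := fun v => fderiv_mul_apply (smoothOn.differentiableAt hU F hx) (smoothOn.differentiableAt hU G hx) v
    change (soulDeriv hU s (F * G)).1 x =
      F.1 x * (soulDeriv hU s G).1 x + (soulDeriv hU s F).1 x * G.1 x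
    simp only [soulDeriv_apply hU s _ hx, Finset.mul_sum, Finset.sum_mul,
      ← Finset.sum_add_distrib]
    refine Finset.sum_congr rfl fun a _ => ?_
    have h2 : fderiv ℝ (F * G).1 x (Pi.single a 1) = _ := h (Pi.single a 1)
    rw [h2, add_mul, mul_assoc, mul_assoc, ← even_mul_comm (soul (s a)).2 (G.1 x), mul_assoc]
  · change (soulDeriv hU s (F * G)).1 x =
      F.1 x * (soulDeriv hU s G).1 x + (soulDeriv hU s F).1 x * G.1 x
    simp [(soulDeriv hU s (F * G)).2.2 x hx, F.2.2 x hx, G.2.2 x hx]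

/-- The coefficients are constant, so iterating the derivation only produces higher derivatives of
`F`. The result is the inner sum in the definition of `subst`. -/
theorem soulDeriv_pow_apply (hU : IsOpen U) (s : ι → evenPart μ) (F : smoothOn μ U) (n : ℕ) :
    ∀ x ∈ U, ((soulDeriv hU s ^ n) F).1 x = ∑ a : Fin n → ι,
      iteratedFDeriv ℝ n F.1 x (fun l => Pi.single (a l) 1) *
        ((∏ l, soul (s (a l)) : evenPart μ) : Grassmann μ) := by
  induction n with
  | zero => intro x _; simp
  | succ n ih =>
    intro x hx
    rw [pow_succ', Module.End.mul_apply, soulDeriv_apply hU s _ hx]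
    -- The induction hypothesis is needed on a neighbourhood of `x`, since it is about to be
    -- differentiated.
    have hev : ((soulDeriv hU s ^ n) F).1 =ᶠ[nhds x] fun y => ∑ a : Fin n → ι,
        iteratedFDeriv ℝ n F.1 y (fun l => Pi.single (a l) 1) *
          ((∏ l, soul (s (a l)) : evenPart μ) : Grassmann μ) := by
      filter_upwards [hU.mem_nhds hx] with y hy using ih y hy
    have hd : DifferentiableAt ℝ (iteratedFDeriv ℝ n F.1) x :=
      (smoothOn.contDiffAt hU F hx).differentiableAt_iteratedFDeriv (by exact_mod_cast WithTop.coe_lt_top _)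
    have hda : ∀ a : Fin n → ι, DifferentiableAt ℝ
        (fun y => iteratedFDeriv ℝ n F.1 y (fun l => Pi.single (a l) 1)) x := fun a =>
      (ContinuousMultilinearMap.apply ℝ (fun _ : Fin n => (ι → ℝ)) (Grassmann μ)
        (fun l => Pi.single (a l) 1)).differentiableAt.comp x hd
    have hfd : ∀ (a : Fin n → ι) v,
        fderiv ℝ (fun y => iteratedFDeriv ℝ n F.1 y (fun l => Pi.single (a l) 1)) x v =
          iteratedFDeriv ℝ (n + 1) F.1 x (Fin.cons v fun l => Pi.single (a l) 1) := fun a v => by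
      have h := ((ContinuousMultilinearMap.apply ℝ (fun _ : Fin n => (ι → ℝ)) (Grassmann μ)
        (fun l => Pi.single (a l) 1)).hasFDerivAt.comp x hd.hasFDerivAt).fderiv
      rw [iteratedFDeriv_succ_apply_left]
      exact DFunLike.congr_fun h v
    have hterm : ∀ v, fderiv ℝ ((soulDeriv hU s ^ n) F).1 x v = ∑ a : Fin n → ι,
        iteratedFDeriv ℝ (n + 1) F.1 x (Fin.cons v fun l => Pi.single (a l) 1) *
          ((∏ l, soul (s (a l)) : evenPart μ) : Grassmann μ) := fun v => by
      rw [hev.fderiv_eq, fderiv_fun_sum fun a _ =>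
        (hasFDerivAt_mul (hda a).hasFDerivAt (hasFDerivAt_const _ x)).differentiableAt,
        _root_.sum_apply]
      refine Finset.sum_congr rfl fun a _ => ?_
      rw [fderiv_mul_apply (hda a) (differentiableAt_const _), hfd]
      simp
    simp only [hterm, Finset.sum_mul]
    -- The direction of the new derivative and the multi-index of length `n` are joined into one
    -- multi-index of length `n + 1`, with the new direction first.
    rw [← Fintype.sum_prod_type', ← (Fin.consEquiv fun _ => ι).sum_comp]
    refine Finset.sum_congr rfl fun a _ => ?_
    obtain ⟨b, a⟩ := a
    rw [mul_assoc, Fin.prod_univ_succ, MulMemClass.coe_mul,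
      even_mul_comm (soul (s (Fin.consEquiv (fun _ => ι) (b, a) 0))).2]
    congr 2
    funext l
    refine Fin.cases ?_ (fun l => ?_) l <;> simp [Fin.consEquiv]

theorem soulDeriv_pow_eq_zero (hU : IsOpen U) (s : ι → evenPart μ) :
    soulDeriv hU s ^ (Fintype.card μ + 1) = 0 := by
  refine LinearMap.ext fun F => Subtype.ext (funext fun x => ?_)
  by_cases hx : x ∈ U
  · rw [soulDeriv_pow_apply hU s F _ x hx]
    simp [prod_soul_eq_zero (Nat.lt_succ_self _)]
  · exact ((soulDeriv hU s ^ (Fintype.card μ + 1)) F).2.2 x hx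

/-- The flow at the time `t` of the derivation `soulDeriv`. -/
def soulFlow (hU : IsOpen U) (s : ι → evenPart μ) (t : ℝ) (F : smoothOn μ U) : smoothOn μ U :=
  ∑ n ∈ Finset.range (Fintype.card μ + 1), (t ^ n * (n.factorial : ℝ)⁻¹) • (soulDeriv hU s ^ n) F

/-- The flow is the exponential of the nilpotent derivation `t • soulDeriv hU s`, and exponentials
of nilpotent derivations respect products. -/
theorem soulFlow_mul (hU : IsOpen U) (s : ι → evenPart μ) (t : ℝ) (F G : smoothOn μ U) :
    soulFlow hU s t (F * G) = soulFlow hU s t F * soulFlow hU s t G := by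
  -- `IsNilpotent.exp` has rational coefficients. Restricting the real structure makes them agree
  -- with real scalars by definition.
  let : Module ℚ (smoothOn μ U) := Module.compHom _ (algebraMap ℚ ℝ)
  have hq : ∀ (q : ℚ) (F : smoothOn μ U), q • F = (q : ℝ) • F := fun q F => rfl
  have h0 : (t • soulDeriv hU s) ^ (Fintype.card μ + 1) = 0 := by
    rw [smul_pow, soulDeriv_pow_eq_zero, smul_zero]
  have he : ∀ F, IsNilpotent.exp (t • soulDeriv hU s) F = soulFlow hU s t F := fun F => by
    rw [IsNilpotent.exp_eq_sum h0, soulFlow, LinearMap.sum_apply]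
    refine Finset.sum_congr rfl fun n _ => ?_
    rw [LinearMap.smul_apply, hq, smul_pow, LinearMap.smul_apply, smul_smul, mul_comm]
    simp
  have h := Module.End.exp_mul_of_derivation ℝ (smoothOn μ U) (t • soulDeriv hU s)
    (fun F G => by simp [soulDeriv_mul, mul_smul_comm, smul_mul_assoc]) ⟨_, h0⟩ F G
  simpa only [he] using h

end

/-! ### The flow of the derivation and its relation to substitution. -/

section
variable {ι κ μ : Type} [Fintype ι] [DecidableEq ι] [Fintype κ] [Fintype μ] {U : Set (ι → ℝ)}

theorem soulFlow_apply (hU : IsOpen U) (s : ι → evenPart μ) (t : ℝ) (F : smoothOn μ U)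
    (x : ι → ℝ) : (soulFlow hU s t F).1 x = ∑ n ∈ Finset.range (Fintype.card μ + 1),
      (t ^ n * (n.factorial : ℝ)⁻¹) • ((soulDeriv hU s ^ n) F).1 x := by
  have h : ∀ G : smoothOn μ U, G.1 x =
      ((LinearMap.proj x : ((ι → ℝ) → Grassmann μ) →ₗ[ℝ] Grassmann μ) ∘ₗ
        (smoothOn μ U).toSubmodule.subtype) G := fun _ => rfl
  rw [h, soulFlow, map_sum]
  refine Finset.sum_congr rfl fun n _ => ?_
  rw [map_smul, ← h]

theorem soulFlow_zero (hU : IsOpen U) (s : ι → evenPart μ) (F : smoothOn μ U) (x : ι → ℝ) :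
    (soulFlow hU s 0 F).1 x = F.1 x := by
  rw [soulFlow_apply, Finset.sum_range_succ']
  simp

/-- This is the rule `d/dt exp(tD) F = exp(tD) (D F)`. It is exact for the truncated series because
the first omitted power of `D` is zero. -/
theorem hasDerivAt_soulFlow (hU : IsOpen U) (s : ι → evenPart μ) (t : ℝ) (F : smoothOn μ U)
    (x : ι → ℝ) : HasDerivAt (fun t => (soulFlow hU s t F).1 x)
      ((soulFlow hU s t (soulDeriv hU s F)).1 x) t := by
  have h : ∀ n ∈ Finset.range (Fintype.card μ + 1), HasDerivAt
      (fun t : ℝ => (t ^ n * (n.factorial : ℝ)⁻¹) • ((soulDeriv hU s ^ n) F).1 x)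
      ((n * t ^ (n - 1) * (n.factorial : ℝ)⁻¹) • ((soulDeriv hU s ^ n) F).1 x) t := fun n _ =>
    ((hasDerivAt_pow n t).mul_const _).smul_const _
  simp only [soulFlow_apply]
  refine (HasDerivAt.fun_sum h).congr_deriv ?_
  have hz : ((soulDeriv hU s ^ (Fintype.card μ + 1)) F).1 x = 0 := by
    rw [soulDeriv_pow_eq_zero]
    rfl
  -- The constant term drops out on the left and the top term vanishes on the right by nilpotency;
  -- the other terms match after shifting the index by one.
  rw [Finset.sum_range_succ', Finset.sum_range_succ, ← Module.End.mul_apply, ← pow_succ, hz]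
  simp only [Nat.cast_zero, zero_mul, zero_smul, smul_zero, add_zero]
  refine Finset.sum_congr rfl fun n _ => ?_
  rw [← Module.End.mul_apply, ← pow_succ]
  congr 1
  rw [Nat.factorial_succ]
  have h1 : ((n : ℝ) + 1) ≠ 0 := by positivity
  push_cast
  field_simp

/-- Every term of positive order contains a soul as a factor, and the body kills it. -/
theorem body_soulFlow (hU : IsOpen U) (s : ι → evenPart μ) (t : ℝ) (F : smoothOn μ U)
    {x : ι → ℝ} (hx : x ∈ U) : body ((soulFlow hU s t F).1 x) = body (F.1 x) := by
  rw [soulFlow_apply, Finset.sum_range_succ', map_add, map_sum, Finset.sum_eq_zero]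
  · simp
  · intro n _
    rw [pow_succ' (soulDeriv hU s), Module.End.mul_apply, soulDeriv_apply hU s _ hx]
    simp [body_soul]

theorem soulFlow_mem (hU : IsOpen U) (s : ι → evenPart μ) (t : ℝ) (F : smoothOn μ U)
    (hF : ∀ x ∈ U, F.1 x ∈ parityPart μ 0) {x : ι → ℝ} (hx : x ∈ U) :
    (soulFlow hU s t F).1 x ∈ parityPart μ 0 := by
  have h : ∀ n : ℕ, ∀ y ∈ U, ((soulDeriv hU s ^ n) F).1 y ∈ parityPart μ 0 := by
    intro n
    induction n with
    | zero => simpa using hF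
    | succ n ih =>
      intro y hy
      rw [pow_succ', Module.End.mul_apply, soulDeriv_apply hU s _ hy]
      refine Submodule.sum_mem _ fun a _ => mul_mem_even (fderiv_mem ?_ _) (soul (s a)).2
      filter_upwards [hU.mem_nhds hy] with w hw using ih w hw
  rw [soulFlow_apply]
  exact Submodule.sum_mem _ fun n _ => Submodule.smul_mem _ _ (h n x hx)

/-- The substitution of odd coordinates as a continuous linear map. -/
def oddSubstCLM (z : Point ι κ μ) : Grassmann κ →L[ℝ] Grassmann μ :=
  LinearMap.toContinuousLinearMap z.oddSubst.toLinearMap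

theorem contDiffOn_oddSubst (z : Point ι κ μ) {f : (ι → ℝ) → Grassmann κ}
    (hf : ContDiffOn ℝ ∞ f U) : ContDiffOn ℝ ∞ (fun x => z.oddSubst (f x)) U :=
  (oddSubstCLM z).contDiff.comp_contDiffOn hf

/-- The substitution of the odd coordinates is a continuous linear map, so it commutes with the
iterated derivatives in the even ones. It can therefore be done first, and what remains is the
Taylor series. -/
theorem subst_eq_soulFlow (hU : IsOpen U) {z : Point ι κ μ} (hz : z.base ∈ U)
    {f : (ι → ℝ) → Grassmann κ} (hf : ContDiffOn ℝ ∞ f U) :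
    subst f z =
      (soulFlow hU z.even 1 (smoothOn.mk (contDiffOn_oddSubst z hf))).1 z.base := by
  rw [soulFlow_apply, subst]
  refine Finset.sum_congr rfl fun n _ => ?_
  rw [soulDeriv_pow_apply hU _ _ _ _ hz, one_pow, one_mul]
  congr 1
  refine Finset.sum_congr rfl fun a _ => ?_
  rw [((smoothOn.mk_eventuallyEq hU (contDiffOn_oddSubst z hf) hz).iteratedFDeriv ℝ n).eq_of_nhds]
  have hfz : ContDiffAt ℝ n f z.base :=
    (hf.contDiffAt (hU.mem_nhds hz)).of_le (by exact_mod_cast le_top)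
  have h := (oddSubstCLM z).iteratedFDeriv_comp_left hfz le_rfl
  have h2 := DFunLike.congr_fun h (fun l => Pi.single (a l) 1)
  exact congrArg (· * _) h2.symm

/-- Substitution is multiplicative. -/
theorem subst_mul (hU : IsOpen U) {z : Point ι κ μ} (hz : z.base ∈ U)
    {f g : (ι → ℝ) → Grassmann κ} (hf : ContDiffOn ℝ ∞ f U) (hg : ContDiffOn ℝ ∞ g U) :
    subst (fun x => f x * g x) z = subst f z * subst g z := by
  rw [subst_eq_soulFlow hU hz hf, subst_eq_soulFlow hU hz hg,
    subst_eq_soulFlow hU hz (contDiffOn_mul hf hg)]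
  have h : smoothOn.mk (contDiffOn_oddSubst z (contDiffOn_mul hf hg)) =
      smoothOn.mk (contDiffOn_oddSubst z hf) * smoothOn.mk (contDiffOn_oddSubst z hg) := by
    refine Subtype.ext (funext fun x => ?_)
    change _ = (smoothOn.mk (contDiffOn_oddSubst z hf)).1 x *
      (smoothOn.mk (contDiffOn_oddSubst z hg)).1 x
    by_cases hx : x ∈ U
    · simp only [smoothOn.mk_apply _ hx, map_mul]
    · simp [smoothOn.mk, hx]
  rw [h, soulFlow_mul]
  rfl

theorem body_subst (hU : IsOpen U) {z : Point ι κ μ} (hz : z.base ∈ U)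
    {f : (ι → ℝ) → Grassmann κ} (hf : ContDiffOn ℝ ∞ f U) :
    body (subst f z) = body (f z.base) := by
  rw [subst_eq_soulFlow hU hz hf, body_soulFlow hU _ _ _ hz, smoothOn.mk_apply _ hz,
    body_oddSubst]

theorem subst_mem (hU : IsOpen U) {z : Point ι κ μ} (hz : z.base ∈ U)
    {f : (ι → ℝ) → Grassmann κ} (hf : ContDiffOn ℝ ∞ f U)
    (he : ∀ x ∈ U, f x ∈ parityPart κ 0) : subst f z ∈ parityPart μ 0 := by
  rw [subst_eq_soulFlow hU hz hf]
  refine soulFlow_mem hU _ _ _ (fun x hx => ?_) hz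
  rw [smoothOn.mk_apply _ hx]
  exact oddSubst_mem z (he x hx)

end

/-! ### The logarithm -/

section
variable {κ : Type} [Fintype κ]

/-- The nilpotent part `y / body y - 1`. -/
def relSoul (y : Grassmann κ) : Grassmann κ := (body y)⁻¹ • y - 1

/-- The logarithm of the absolute value of an even invertible Grassmann number. -/
def Grassmann.log (y : Grassmann κ) : Grassmann κ :=
  algebraMap ℝ (Grassmann κ) (Real.log (body y)) +
    ∑ k ∈ Finset.range (Fintype.card κ + 1), ((-1) ^ k / (k + 1) : ℝ) • relSoul y ^ (k + 1)

open Grassmann (log)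

theorem relSoul_mem {y : Grassmann κ} (hy : y ∈ parityPart κ 0) :
    relSoul y ∈ parityPart κ 0 :=
  Submodule.sub_mem _ (Submodule.smul_mem _ _ hy) one_mem_even

theorem body_relSoul {y : Grassmann κ} (hy : body y ≠ 0) : body (relSoul y) = 0 := by
  simp [relSoul, hy]

/-- The algebra common to even and odd derivatives of the logarithm: `v`, `c` and `w` stand for the
derivatives of `y`, of its body and of `relSoul y`. Termwise differentiation gives a geometric
series that inverts `1 + relSoul y`. -/
theorem log_derivative_formula {y : Grassmann κ} (hb : body y ≠ 0) (c : ℝ) {v w : Grassmann κ}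
    (hw : w = (body y)⁻¹ • v - (c / body y ^ 2) • y) :
    y * (algebraMap ℝ (Grassmann κ) ((body y)⁻¹ * c) +
      ∑ k ∈ Finset.range (Fintype.card κ + 1),
        ((-1) ^ k / (k + 1) : ℝ) • ((k + 1 : ℝ) • (relSoul y ^ k * w))) = v := by
  have h1 : ∑ k ∈ Finset.range (Fintype.card κ + 1),
        ((-1) ^ k / (k + 1) : ℝ) • ((k + 1 : ℝ) • (relSoul y ^ k * w)) =
      (∑ k ∈ Finset.range (Fintype.card κ + 1), (-relSoul y) ^ k) * w := by
    rw [Finset.sum_mul]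
    refine Finset.sum_congr rfl fun k _ => ?_
    have hk : ((k : ℝ) + 1) ≠ 0 := by positivity
    rw [smul_smul, div_mul_cancel₀ _ hk, neg_pow (relSoul y)]
    rcases neg_one_pow_eq_or ℝ k with h | h <;> rcases Nat.even_or_odd k with h' | h' <;>
      simp [h'.neg_one_pow]
  -- The last term of the logarithm has the vanishing power `Fintype.card κ + 1`, yet its formal
  -- derivative supplies the final term that this series needs.
  have h2 : (1 + relSoul y) * ∑ k ∈ Finset.range (Fintype.card κ + 1), (-relSoul y) ^ k = 1 := by
    have h := mul_neg_geom_sum (-relSoul y) (Fintype.card κ + 1)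
    rw [pow_eq_zero_of_body (by simp [body_relSoul hb])] at h
    simpa using h
  have h3 : y = body y • (1 + relSoul y) := by
    simp [relSoul, smul_smul, hb]
  have h4 : y * ∑ k ∈ Finset.range (Fintype.card κ + 1), (-relSoul y) ^ k =
      algebraMap ℝ _ (body y) := by
    have h := congrArg (body y • ·) h2
    simp only [← smul_mul_assoc, ← h3] at h
    rw [h, Algebra.algebraMap_eq_smul_one]
  rw [h1, mul_add, ← mul_assoc, h4, hw, ← Algebra.commutes, ← Algebra.smul_def, ← Algebra.smul_def,
    smul_sub, smul_smul, smul_smul, mul_inv_cancel₀ hb, one_smul]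
  have : body y * (c / body y ^ 2) = (body y)⁻¹ * c := by field_simp
  rw [this]
  abel

/-- The derivative at `y` is division by `y`. The direction `v` need not be even: the power rule
only requires `relSoul y` to be central, and it is even. -/
theorem hasFDerivAt_log {y : Grassmann κ} (hy : y ∈ parityPart κ 0) (hb : body y ≠ 0) :
    ∃ L : Grassmann κ →L[ℝ] Grassmann κ, HasFDerivAt log L y ∧ ∀ v, y * L v = v := by
  have hbody : HasFDerivAt (fun y : Grassmann κ => body y) (bodyCLM κ) y :=
    (bodyCLM κ).hasFDerivAt
  obtain ⟨N, hN, hNv⟩ : ∃ N : Grassmann κ →L[ℝ] Grassmann κ, HasFDerivAt relSoul N y ∧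
      ∀ v, N v = (body y)⁻¹ • v - (body v / body y ^ 2) • y := by
    have h := (((hasDerivAt_inv hb).comp_hasFDerivAt y hbody).smul (hasFDerivAt_id y)).sub_const 1
    refine ⟨_, h, fun v => ?_⟩
    simp [bodyCLM, sub_eq_add_neg, neg_smul, div_eq_mul_inv, mul_comm]
  have hP : ∀ k : ℕ, ∃ P : Grassmann κ →L[ℝ] Grassmann κ,
      HasFDerivAt (fun y => relSoul y ^ (k + 1)) P y ∧
        ∀ v, P v = (k + 1 : ℝ) • (relSoul y ^ k * N v) := by
    intro k
    induction k with
    | zero => exact ⟨N, by simpa using hN, by simp⟩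
    | succ k ih =>
      obtain ⟨P, hP, hPv⟩ := ih
      refine ⟨_, by simpa only [pow_succ (n := k + 1)] using hasFDerivAt_mul hP hN, fun v => ?_⟩
      change relSoul y ^ (k + 1) * N v + P v * relSoul y = _
      rw [hPv, smul_mul_assoc, mul_assoc, ← even_mul_comm (relSoul_mem hy), ← mul_assoc,
        ← pow_succ]
      push_cast
      module
  choose P hP hPv using hP
  have hlog : HasFDerivAt (fun y : Grassmann κ => algebraMap ℝ (Grassmann κ) (Real.log (body y)))
      ((LinearMap.toContinuousLinearMap (Algebra.linearMap ℝ (Grassmann κ))).comp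
        ((body y)⁻¹ • bodyCLM κ)) y :=
    (LinearMap.toContinuousLinearMap (Algebra.linearMap ℝ (Grassmann κ))).hasFDerivAt.comp y
      (hbody.log hb)
  refine ⟨_, hlog.add (HasFDerivAt.fun_sum fun k _ => (hP k).fun_const_smul
    ((-1) ^ k / (k + 1) : ℝ)), fun v => ?_⟩
  refine Eq.trans ?_ (log_derivative_formula hb (body v) (hNv v))
  simp [hPv, bodyCLM, Algebra.smul_def]

/-- Contraction kills scalars, so the body counts as a constant and `log_derivative_formula` applies
with `c = 0`. -/
theorem contractLeft_log (d : Module.Dual ℝ (κ → ℝ)) {y : Grassmann κ}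
    (hy : y ∈ parityPart κ 0) (hb : body y ≠ 0) :
    y * CliffordAlgebra.contractLeft d (log y) = CliffordAlgebra.contractLeft d y := by
  have hN : CliffordAlgebra.contractLeft d (relSoul y) =
      (body y)⁻¹ • CliffordAlgebra.contractLeft d y := by
    simp [relSoul]
  have hP : ∀ k : ℕ, CliffordAlgebra.contractLeft d (relSoul y ^ (k + 1)) =
      (k + 1 : ℝ) • (relSoul y ^ k * CliffordAlgebra.contractLeft d (relSoul y)) := by
    intro k
    induction k with
    | zero => simp
    | succ k ih =>
      rw [pow_succ, contractLeft_even_mul d (pow_mem_even (relSoul_mem hy) _), ih,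
        smul_mul_assoc, mul_assoc, ← even_mul_comm (relSoul_mem hy), ← mul_assoc, ← pow_succ]
      push_cast
      module
  have h := log_derivative_formula hb 0 (v := CliffordAlgebra.contractLeft d y)
    (w := CliffordAlgebra.contractLeft d (relSoul y)) (by simp [hN])
  rw [← h, log]
  simp [hP]

theorem partialD_log {ι : Type} [Fintype ι] [DecidableEq ι] (a : ι ⊕ κ)
    {f : (ι → ℝ) → Grassmann κ} {x : ι → ℝ} (hf : DifferentiableAt ℝ f x)
    (he : f x ∈ parityPart κ 0) (hb : body (f x) ≠ 0) :
    f x * partialD a (fun y => log (f y)) x = partialD a f x := by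
  rcases a with a | k
  · obtain ⟨L, hL, hLv⟩ := hasFDerivAt_log he hb
    have h := (hL.comp x hf.hasFDerivAt).fderiv
    change f x * fderiv ℝ (log ∘ f) x _ = fderiv ℝ f x _
    rw [h]
    exact hLv _
  · exact contractLeft_log _ he hb

theorem contDiffAt_log {E : Type*} [NormedAddCommGroup E] [NormedSpace ℝ E]
    {f : E → Grassmann κ} {x : E} {n : WithTop ℕ∞} (hf : ContDiffAt ℝ n f x)
    (hb : body (f x) ≠ 0) : ContDiffAt ℝ n (fun y => log (f y)) x := by
  have hbody : ContDiffAt ℝ n (fun y => body (f y)) x :=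
    (bodyCLM κ).contDiff.contDiffAt.comp x hf
  have hN : ContDiffAt ℝ n (fun y => relSoul (f y)) x :=
    ((hbody.inv hb).smul hf).sub contDiffAt_const
  have hP : ∀ k : ℕ, ContDiffAt ℝ n (fun y => relSoul (f y) ^ k) x := by
    intro k
    induction k with
    | zero => simpa using contDiffAt_const
    | succ k ih => simpa only [pow_succ] using contDiffAt_mul ih hN
  refine ContDiffAt.add ?_ (ContDiffAt.sum fun k _ =>
    ContDiffAt.fun_smul contDiffAt_const (hP (k + 1)))
  exact (LinearMap.toContinuousLinearMap (Algebra.linearMap ℝ (Grassmann κ))).contDiff.contDiffAt.comp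
    x (hbody.log hb)

theorem map_log (φ : Grassmann κ →ₐ[ℝ] Grassmann κ) (hφ : ∀ y, body (φ y) = body y)
    (y : Grassmann κ) : φ (log y) = log (φ y) := by
  simp [log, relSoul, hφ]

/-- A path `w` with `u w' = u'` has the same derivative as `log u`, because `u` is invertible.
Equality at time 0 then propagates to time 1. -/
theorem log_eq_of_hasDerivAt {u u' w : ℝ → Grassmann κ} (hu : ∀ t, HasDerivAt u (u' t) t)
    (he : ∀ t, u t ∈ parityPart κ 0) (hb : ∀ t, body (u t) ≠ 0) (w' : ℝ → Grassmann κ)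
    (hw : ∀ t, HasDerivAt w (w' t) t) (huw : ∀ t, u t * w' t = u' t) (h0 : log (u 0) = w 0) :
    log (u 1) = w 1 := by
  have h : ∀ t, HasDerivAt (fun t => log (u t) - w t) 0 t := fun t => by
    obtain ⟨L, hL, hLv⟩ := hasFDerivAt_log (he t) (hb t)
    have h1 : HasDerivAt (fun t => log (u t) - w t) (L (u' t) - w' t) t :=
      (hL.comp_hasDerivAt t (hu t)).sub (hw t)
    have h2 : L (u' t) = w' t :=
      (isUnit_of_body_ne_zero (hb t)).mul_left_cancel (by rw [hLv, huw])
    rwa [h2, sub_self] at h1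
  have h2 := is_const_of_deriv_eq_zero (fun t => (h t).differentiableAt) (fun t => (h t).deriv) 1 0
  simpa [h0, sub_eq_zero] using h2

theorem log_mul {x y : Grassmann κ} (hx : x ∈ parityPart κ 0) (hy : y ∈ parityPart κ 0)
    (hbx : body x ≠ 0) (hby : body y ≠ 0) : log (x * y) = log x + log y := by
  -- Each factor is joined to its body by a segment. The body is constant along it, so the path
  -- stays even and invertible, and at time 0 the claim is the one for real logarithms.
  have hray : ∀ z : Grassmann κ, z ∈ parityPart κ 0 → body z ≠ 0 →
      ∃ u : ℝ → Grassmann κ, u 1 = z ∧ u 0 = algebraMap ℝ _ (body z) ∧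
        (∀ t, u t ∈ parityPart κ 0) ∧ (∀ t, body (u t) ≠ 0) ∧
        ∃ u' w' : ℝ → Grassmann κ, (∀ t, HasDerivAt u (u' t) t) ∧
          (∀ t, HasDerivAt (fun s => log (u s)) (w' t) t) ∧ ∀ t, u t * w' t = u' t := by
    intro z hz hbz
    set b : Grassmann κ := algebraMap ℝ _ (body z) with hbdef
    have he : ∀ t : ℝ, b + t • (z - b) ∈ parityPart κ 0 := fun t =>
      Submodule.add_mem _ (algebraMap_mem_even _)
        (Submodule.smul_mem _ _ (Submodule.sub_mem _ hz (algebraMap_mem_even _)))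
    have hb : ∀ t : ℝ, body (b + t • (z - b)) ≠ 0 := fun t => by simpa [hbdef] using hbz
    have hd : ∀ t : ℝ, HasDerivAt (fun t : ℝ => b + t • (z - b)) (z - b) t := fun t => by
      simpa using ((hasDerivAt_id t).smul_const (z - b)).const_add b
    choose L hL hLv using fun t => hasFDerivAt_log (he t) (hb t)
    exact ⟨_, by simp, by simp, he, hb, fun _ => z - b, fun t => L t (z - b), hd,
      fun t => by simpa only [Function.comp_def] using (hL t).comp_hasDerivAt t (hd t), fun t => hLv t _⟩
  obtain ⟨u, hu1, hu0, hue, hub, u', p, hu, hp, hup⟩ := hray x hx hbx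
  obtain ⟨v, hv1, hv0, hve, hvb, v', q, hv, hq, hvq⟩ := hray y hy hby
  have h := log_eq_of_hasDerivAt (fun t => hasDerivAt_mul (hu t) (hv t))
    (fun t => mul_mem_even (hue t) (hve t)) (fun t => by simp [hub t, hvb t])
    (fun t => p t + q t) (fun t => (hp t).add (hq t)) (fun t => by
      rw [mul_add, ← hup, ← hvq]
      rw [mul_assoc (u t) (p t), ← even_mul_comm (hve t) (p t), mul_assoc, mul_assoc, add_comm])
    (by
      have h1 : ∀ r : ℝ, r ≠ 0 → relSoul (algebraMap ℝ (Grassmann κ) r) = 0 := fun r hr => by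
        simp [relSoul, Algebra.smul_def, ← map_mul, hr]
      change log (u 0 * v 0) = log (u 0) + log (v 0)
      have h2 : ∀ r : ℝ, r ≠ 0 →
          log (algebraMap ℝ (Grassmann κ) r) = algebraMap ℝ _ (Real.log r) := fun r hr => by
        simp [log, h1 r hr]
      rw [hu0, hv0, ← map_mul, h2 _ hbx, h2 _ hby, h2 _ (mul_ne_zero hbx hby),
        Real.log_mul hbx hby, map_add])
  change log (u 1 * v 1) = log (u 1) + log (v 1) at h
  rwa [hu1, hv1] at h

/-- Let `F` and `G = log F` be the functions after odd substitution. Applying the multiplicative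
flow to `F * D G = D F` gives the equation required by `log_eq_of_hasDerivAt` for the flows of `F`
and `G`. -/
theorem subst_log {ι : Type} [Fintype ι] [DecidableEq ι] {U : Set (ι → ℝ)} (hU : IsOpen U)
    {z : Point ι κ κ} (hz : z.base ∈ U) {f : (ι → ℝ) → Grassmann κ} (hf : ContDiffOn ℝ ∞ f U)
    (he : ∀ x ∈ U, f x ∈ parityPart κ 0) (hb : ∀ x ∈ U, body (f x) ≠ 0) :
    subst (fun x => log (f x)) z = log (subst f z) := by
  have hg : ContDiffOn ℝ ∞ (fun x => log (f x)) U := fun x hx =>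
    (contDiffAt_log (hf.contDiffAt (hU.mem_nhds hx)) (hb x hx)).contDiffWithinAt
  rw [subst_eq_soulFlow hU hz hf, subst_eq_soulFlow hU hz hg]
  set F := smoothOn.mk (contDiffOn_oddSubst z hf)
  set G := smoothOn.mk (contDiffOn_oddSubst z hg)
  have hF : ∀ x ∈ U, F.1 x = z.oddSubst (f x) := fun x hx => smoothOn.mk_apply _ hx
  have hG : ∀ x ∈ U, G.1 x = log (F.1 x) := fun x hx => by
    rw [smoothOn.mk_apply _ hx, hF x hx, map_log _ (body_oddSubst z)]
  have hFe : ∀ x ∈ U, F.1 x ∈ parityPart κ 0 := fun x hx => by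
    rw [hF x hx]
    exact oddSubst_mem z (he x hx)
  have hFb : ∀ x ∈ U, body (F.1 x) ≠ 0 := fun x hx => by
    rw [hF x hx, body_oddSubst]
    exact hb x hx
  have hFG : F * soulDeriv hU z.even G = soulDeriv hU z.even F := by
    refine Subtype.ext (funext fun x => ?_)
    change F.1 x * (soulDeriv hU z.even G).1 x = _
    by_cases hx : x ∈ U
    · rw [soulDeriv_apply hU _ _ hx, soulDeriv_apply hU _ _ hx, Finset.mul_sum]
      refine Finset.sum_congr rfl fun a _ => ?_
      have hev : G.1 =ᶠ[nhds x] fun y => log (F.1 y) := by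
        filter_upwards [hU.mem_nhds hx] with y hy using hG y hy
      have h := partialD_log (Sum.inl a) (smoothOn.differentiableAt hU F hx) (hFe x hx) (hFb x hx)
      rw [← partialD_congr _ hev] at h
      rw [← mul_assoc]
      exact congrArg (· * _) h
    · rw [(soulDeriv hU z.even F).2.2 x hx, F.2.2 x hx, zero_mul]
  refine (log_eq_of_hasDerivAt (fun t => hasDerivAt_soulFlow hU z.even t F z.base)
    (fun t => soulFlow_mem hU _ _ _ hFe hz)
    (fun t => by rw [body_soulFlow hU _ _ _ hz]; exact hFb _ hz) _
    (fun t => hasDerivAt_soulFlow hU z.even t G z.base) (fun t => ?_) ?_).symm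
  · rw [← hFG, soulFlow_mul]
    rfl
  · rw [soulFlow_zero, soulFlow_zero, hG _ hz]

end

/-! ### Divergences and modular classes -/

namespace Supermanifold

section
variable {ι κ : Type} [Fintype ι] [DecidableEq ι] [Fintype κ] [DecidableEq κ]
  {M : Supermanifold ι κ}

open Grassmann (log)

/-- The local expression `∂Xᵃ/∂xᵃ`. -/
def VectorField.coordDiv {p : ZMod 2} (X : M.VectorField p) (i : M.index) (x : ι → ℝ) :
    Grassmann κ := ∑ a, partialD a (X.comp i a) x

/-- For an odd field the sign exponent contains `1 + 1 = 0`. The Leibniz rule adds no sign either: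
even coordinates have ordinary derivatives, and the components along odd coordinates are even. -/
theorem VectorField.lieDeriv_eq (X : M.VectorField 1) {i : M.index} {x : ι → ℝ}
    (hx : x ∈ (M.chart i).target) {s : (ι → ℝ) → Grassmann κ} (hs : DifferentiableAt ℝ s x) :
    X.lieDeriv i s x = X.coordDiv i x * s x + X.act i s x := by
  rw [lieDeriv, coordDiv, act, Finset.sum_mul, ← Finset.sum_add_distrib]
  refine Finset.sum_congr rfl fun a _ => ?_
  rw [show (1 + 1 : ZMod 2) = 0 from rfl, mul_zero, uzpow_zero, one_smul]
  have hX : DifferentiableAt ℝ (X.comp i a) x :=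
    (X.contDiffAt_comp hx a).differentiableAt (by simp)
  rcases a with a | k
  · exact (fderiv_mul_apply hX hs _).trans (add_comm _ _)
  · exact partialD_mul _ hX hs (X.parity_comp i (Sum.inr k) x hx)

theorem VectorField.act_mul {p : ZMod 2} (X : M.VectorField p) (i : M.index) {x : ι → ℝ}
    {f g : (ι → ℝ) → Grassmann κ} (hf : DifferentiableAt ℝ f x) (hg : DifferentiableAt ℝ g x)
    (he : f x ∈ parityPart κ 0) :
    X.act i (fun y => f y * g y) x = X.act i f x * g x + f x * X.act i g x := by
  simp only [act, Finset.sum_mul, Finset.mul_sum, ← Finset.sum_add_distrib]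
  refine Finset.sum_congr rfl fun a _ => ?_
  rw [partialD_mul a hf hg he, mul_add, ← mul_assoc, ← mul_assoc, ← mul_assoc,
    even_mul_comm he (X.comp i a x)]

theorem VectorField.mul_act_log {p : ZMod 2} (X : M.VectorField p) (i : M.index) {x : ι → ℝ}
    {f : (ι → ℝ) → Grassmann κ} (hf : DifferentiableAt ℝ f x)
    (he : f x ∈ parityPart κ 0) (hb : body (f x) ≠ 0) :
    f x * X.act i (fun y => log (f y)) x = X.act i f x := by
  simp only [act, Finset.mul_sum]
  refine Finset.sum_congr rfl fun a _ => ?_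
  rw [← mul_assoc, even_mul_comm he, mul_assoc, partialD_log a hf he hb]

namespace BerezinVolume

theorem contDiffAt_density (ρ : M.BerezinVolume) {i : M.index} {x : ι → ℝ}
    (hx : x ∈ (M.chart i).target) : ContDiffAt ℝ ∞ (ρ.density i) x :=
  (ρ.smooth_density i).contDiffAt ((M.chart i).open_target.mem_nhds hx)

theorem body_density_ne_zero (ρ : M.BerezinVolume) {i : M.index} {x : ι → ℝ}
    (hx : x ∈ (M.chart i).target) : body (ρ.density i x) ≠ 0 :=
  body_ne_zero_of_isUnit (ρ.isUnit_density i x hx)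

/-- The Berezinian is a factor of an invertible density. Thus its invertibility comes from the
existence of a volume and needs no inversion of the coordinate change. -/
theorem body_berezinian_ne_zero (ρ : M.BerezinVolume) {i j : M.index} {x : ι → ℝ}
    (hx : x ∈ M.overlap i j) : body (berezinian (M.jacobian i j x)) ≠ 0 := by
  have h := ρ.body_density_ne_zero (mem_overlap.mp hx).1
  rw [ρ.density_trans i j x hx, map_mul] at h
  exact left_ne_zero_of_mul h

theorem contDiffAt_log_density (ρ : M.BerezinVolume) {i : M.index} {x : ι → ℝ}
    (hx : x ∈ (M.chart i).target) : ContDiffAt ℝ ∞ (fun y => log (ρ.density i y)) x :=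
  contDiffAt_log (ρ.contDiffAt_density hx) (ρ.body_density_ne_zero hx)

theorem log_density_trans (ρ : M.BerezinVolume) {i j : M.index} {x : ι → ℝ}
    (hx : x ∈ M.overlap i j) :
    log (ρ.density i x) = log (berezinian (M.jacobian i j x)) +
      subst (fun y => log (ρ.density j y)) (M.trans i j x) := by
  have hU := (M.chart j).open_target
  have hz := base_mem_target hx
  rw [subst_log hU hz (ρ.smooth_density j) (ρ.even_density j)
    fun y hy => ρ.body_density_ne_zero hy, ρ.density_trans i j x hx]
  refine log_mul (Subtype.prop _) (subst_mem hU hz (ρ.smooth_density j) (ρ.even_density j))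
    (ρ.body_berezinian_ne_zero hx) ?_
  rw [body_subst hU hz (ρ.smooth_density j)]
  exact ρ.body_density_ne_zero hz

/-- The logarithm of the absolute value of the ratio of two Berezin volumes. -/
def logRatio (ρ ρ' : M.BerezinVolume) (i : M.index) : (ι → ℝ) → Grassmann κ :=
  (M.chart i).target.indicator ((fun x => log (ρ.density i x)) +
    (-1 : ℝ) • fun x => log (ρ'.density i x))

theorem logRatio_eventuallyEq (ρ ρ' : M.BerezinVolume) {i : M.index} {x : ι → ℝ}
    (hx : x ∈ (M.chart i).target) : ρ.logRatio ρ' i =ᶠ[nhds x]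
      (fun x => log (ρ.density i x)) + (-1 : ℝ) • fun x => log (ρ'.density i x) := by
  filter_upwards [(M.chart i).open_target.mem_nhds hx] with y hy
  exact Set.indicator_of_mem hy _

/-- The summand `log Ber` in `log_density_trans` is the same for both volumes and cancels. -/
theorem logRatio_mem (ρ ρ' : M.BerezinVolume) : ρ.logRatio ρ' ∈ M.functions := by
  refine ⟨fun i x hx => ?_, fun i x hx => Set.indicator_of_notMem hx _, fun i j x hx => ?_⟩
  · exact (((ρ.contDiffAt_log_density hx).add ((ρ'.contDiffAt_log_density hx).const_smul
      (-1 : ℝ))).congr_of_eventuallyEq (ρ.logRatio_eventuallyEq ρ' hx)).contDiffWithinAt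
  · have hz := base_mem_target hx
    have hs : ContDiffAt ℝ ∞ ((-1 : ℝ) • fun y => log (ρ'.density j y)) (M.trans i j x).base :=
      (ρ'.contDiffAt_log_density hz).const_smul (-1 : ℝ)
    rw [subst_congr (ρ.logRatio_eventuallyEq ρ' hz),
      (ρ.logRatio_eventuallyEq ρ' (mem_overlap.mp hx).1).eq_of_nhds,
      subst_add (ρ.contDiffAt_log_density hz) hs,
      subst_smul _ (ρ'.contDiffAt_log_density hz)]
    simp only [Pi.add_apply, Pi.smul_apply, ρ.log_density_trans hx, ρ'.log_density_trans hx]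
    module

end BerezinVolume

/-- This isolates the dependence of the divergence on the volume in the term `X(log ρ)`. The two
summands separately need not be global functions. -/
theorem VectorField.IsDivergence.eq_add {X : M.VectorField 1} {ρ : M.BerezinVolume}
    {d : M.index → (ι → ℝ) → Grassmann κ} (h : X.IsDivergence ρ d) {i : M.index} {x : ι → ℝ}
    (hx : x ∈ (M.chart i).target) :
    d i x = X.coordDiv i x + X.act i (fun y => log (ρ.density i y)) x := by
  have hd := (ρ.contDiffAt_density hx).differentiableAt (by simp)
  have he := ρ.even_density i x hx
  refine (ρ.isUnit_density i x hx).mul_left_cancel ?_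
  rw [h.2 i x hx, X.lieDeriv_eq hx hd, mul_add, even_mul_comm he,
    X.mul_act_log i hd he (ρ.body_density_ne_zero hx)]

end

end Supermanifold

/-! ### Independence of the Berezin volume. -/

namespace QManifold

section
variable {ι κ : Type} [Fintype ι] [DecidableEq ι] [Fintype κ] [DecidableEq κ]

/-- The modular class does not depend on the Berezin volume. -/
theorem IsModularClass.unique {M : QManifold ι κ} {c c' : M.Cohomology}
    (h : M.IsModularClass c) (h' : M.IsModularClass c') : c = c' := by
  obtain ⟨ρ, d, hd, rfl⟩ := h
  obtain ⟨ρ', d', hd', rfl⟩ := h'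
  refine (Submodule.Quotient.eq _).mpr ?_
  -- The primitive of the difference of the divergences is the logarithm of the ratio of the
  -- volumes; the coordinate divergences cancel.
  refine ⟨sub_mem d.2.1 d'.2.1, _, ρ.logRatio_mem ρ', fun i x hx => ?_⟩
  have h1 := ρ.contDiffAt_log_density hx
  have h2 := ρ'.contDiffAt_log_density hx
  have hs : ContDiffAt ℝ ∞ ((-1 : ℝ) • fun y => Grassmann.log (ρ'.density i y)) x :=
    h2.const_smul (-1 : ℝ)
  rw [Supermanifold.VectorField.act_congr _ _ (ρ.logRatio_eventuallyEq ρ' hx),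
    M.Q.act_add i h1 hs, M.Q.act_smul i (-1) h2]
  change d.1 i x - d'.1 i x = _
  rw [hd.eq_add hx, hd'.eq_add hx]
  module

end

end QManifold

/-! ### The Berezinian of a product -/

section
variable {κ κ' : Type} [Fintype κ] [DecidableEq κ']

theorem toEven_add (x y : Grassmann κ) : toEven (x + y) = toEven x + toEven y := by
  simp only [toEven, DirectSum.decompose_add]
  rfl

theorem toEven_of_mem_even {x : Grassmann κ} (hx : x ∈ parityPart κ 0) : toEven x = ⟨x, hx⟩ :=
  Subtype.ext (DirectSum.decompose_of_mem_same
    (CliffordAlgebra.evenOdd (0 : QuadraticForm ℝ (κ → ℝ))) hx)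

theorem toEven_of_mem_odd {x : Grassmann κ} (hx : x ∈ parityPart κ 1) : toEven x = 0 :=
  Subtype.ext (DirectSum.decompose_of_mem_ne
    (CliffordAlgebra.evenOdd (0 : QuadraticForm ℝ (κ → ℝ))) hx one_ne_zero)

theorem toEven_incl [Fintype κ'] (t : κ → κ') (x : Grassmann κ) :
    toEven (incl t x) = inclEven t (toEven x) := by
  obtain ⟨y, hy, z, hz, rfl⟩ := exists_even_add_odd x
  rw [map_add, toEven_add, toEven_add, toEven_of_mem_even hy, toEven_of_mem_odd hz,
    toEven_of_mem_even (incl_mem t hy), toEven_of_mem_odd (incl_mem t hz), add_zero, add_zero]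
  rfl

end

section
variable {ι₁ κ₁ ι₂ κ₂ : Type} [Fintype ι₁] [DecidableEq ι₁] [Fintype κ₁] [DecidableEq κ₁]
  [Fintype ι₂] [DecidableEq ι₂] [Fintype κ₂] [DecidableEq κ₂]

/-- The block diagonal supermatrix with two given diagonal blocks. -/
def blockSum (J₁ : Matrix (ι₁ ⊕ κ₁) (ι₁ ⊕ κ₁) (Grassmann κ₁))
    (J₂ : Matrix (ι₂ ⊕ κ₂) (ι₂ ⊕ κ₂) (Grassmann κ₂)) :
    Matrix ((ι₁ ⊕ ι₂) ⊕ (κ₁ ⊕ κ₂)) ((ι₁ ⊕ ι₂) ⊕ (κ₁ ⊕ κ₂)) (Grassmann (κ₁ ⊕ κ₂)) :=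
  Matrix.of fun a b => sumIndex
    (fun b => sumIndex (fun a => incl Sum.inl (J₁ a b)) (fun _ => 0) a)
    (fun b => sumIndex (fun _ => 0) (fun a => incl Sum.inr (J₂ a b)) a) b

/-- `Ring.inverse` is zero on non-units, so a singular odd block would make the Berezinian zero. -/
theorem isUnit_det_of_isUnit_berezinian {J : Matrix (ι₁ ⊕ κ₁) (ι₁ ⊕ κ₁) (Grassmann κ₁)}
    (h : IsUnit (berezinian J)) : IsUnit (J.toBlocks₂₂.map toEven).det := by
  by_contra hd
  refine h.ne_zero ?_
  simp [berezinian, Ring.inverse_non_unit _ hd]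

theorem map_inverse_of_isUnit {R S : Type*} [CommRing R] [CommRing S] (φ : R →+* S) {r : R}
    (hr : IsUnit r) : Ring.inverse (φ r) = φ (Ring.inverse r) := by
  obtain ⟨u, rfl⟩ := hr
  rw [Ring.inverse_unit]
  exact Ring.inverse_unit (Units.map (φ : R →* S) u)

theorem inv_fromBlocks_map {m n : Type*} [Fintype m] [DecidableEq m] [Fintype n] [DecidableEq n]
    {R S T : Type*} [CommRing R] [CommRing S] [CommRing T] (φ : R →+* T) (ψ : S →+* T)
    {A : Matrix m m R} {B : Matrix n n S} (hA : IsUnit A.det) (hB : IsUnit B.det) :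
    (Matrix.fromBlocks (A.map φ) 0 0 (B.map ψ))⁻¹ =
      Matrix.fromBlocks (A⁻¹.map φ) 0 0 (B⁻¹.map ψ) := by
  refine Matrix.inv_eq_right_inv ?_
  rw [Matrix.fromBlocks_multiply]
  simp [← Matrix.map_mul, Matrix.mul_nonsing_inv _ hA, Matrix.mul_nonsing_inv _ hB]

/-- Each of the four parity blocks is block diagonal with respect to the factors, hence so are `D⁻¹`
and `A - B D⁻¹ C`, and the determinants split. Invertibility ensures that the inverses, which
default to zero, are compatible with the inclusions. -/
theorem berezinian_blockSum {J₁ : Matrix (ι₁ ⊕ κ₁) (ι₁ ⊕ κ₁) (Grassmann κ₁)}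
    {J₂ : Matrix (ι₂ ⊕ κ₂) (ι₂ ⊕ κ₂) (Grassmann κ₂)} (h₁ : IsUnit (berezinian J₁))
    (h₂ : IsUnit (berezinian J₂)) :
    berezinian (blockSum J₁ J₂) =
      incl Sum.inl (berezinian J₁) * incl Sum.inr (berezinian J₂) := by
  set φ : evenPart κ₁ →+* evenPart (κ₁ ⊕ κ₂) := (inclEven Sum.inl).toRingHom with hφ
  set ψ : evenPart κ₂ →+* evenPart (κ₁ ⊕ κ₂) := (inclEven Sum.inr).toRingHom with hψ
  set D₁ := J₁.toBlocks₂₂.map toEven with hD₁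
  set D₂ := J₂.toBlocks₂₂.map toEven with hD₂
  have hu₁ : IsUnit D₁.det := isUnit_det_of_isUnit_berezinian h₁
  have hu₂ : IsUnit D₂.det := isUnit_det_of_isUnit_berezinian h₂
  have h0 : toEven (0 : Grassmann (κ₁ ⊕ κ₂)) = 0 := toEven_of_mem_odd (zero_mem _)
  have hm : ∀ {m n : Type} (A : Matrix m m (Grassmann κ₁)) (B : Matrix n n (Grassmann κ₂)),
      (Matrix.fromBlocks (A.map (incl Sum.inl)) 0 0 (B.map (incl Sum.inr))).map toEven =
        Matrix.fromBlocks ((A.map toEven).map φ) 0 0 ((B.map toEven).map ψ) := by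
    intro m n A B
    ext (i | i) (j | j) : 2
    · exact congrArg Subtype.val (toEven_incl (κ' := κ₁ ⊕ κ₂) Sum.inl (A i j))
    · exact congrArg Subtype.val h0
    · exact congrArg Subtype.val h0
    · exact congrArg Subtype.val (toEven_incl (κ' := κ₁ ⊕ κ₂) Sum.inr (B i j))
  have hb₁₁ : (blockSum J₁ J₂).toBlocks₁₁ = Matrix.fromBlocks
      (J₁.toBlocks₁₁.map (incl Sum.inl)) 0 0 (J₂.toBlocks₁₁.map (incl Sum.inr)) := by
    ext (i | i) (j | j) : 2 <;> rfl
  have hb₁₂ : (blockSum J₁ J₂).toBlocks₁₂ = Matrix.fromBlocks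
      (J₁.toBlocks₁₂.map (incl Sum.inl)) 0 0 (J₂.toBlocks₁₂.map (incl Sum.inr)) := by
    ext (i | i) (j | j) : 2 <;> rfl
  have hb₂₁ : (blockSum J₁ J₂).toBlocks₂₁ = Matrix.fromBlocks
      (J₁.toBlocks₂₁.map (incl Sum.inl)) 0 0 (J₂.toBlocks₂₁.map (incl Sum.inr)) := by
    ext (i | i) (j | j) : 2 <;> rfl
  have hb₂₂ : (blockSum J₁ J₂).toBlocks₂₂ = Matrix.fromBlocks
      (J₁.toBlocks₂₂.map (incl Sum.inl)) 0 0 (J₂.toBlocks₂₂.map (incl Sum.inr)) := by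
    ext (i | i) (j | j) : 2 <;> rfl
  have hinv : (Matrix.fromBlocks (D₁⁻¹.map φ) 0 0 (D₂⁻¹.map ψ)).map Subtype.val =
      Matrix.fromBlocks ((D₁⁻¹.map Subtype.val).map (incl (κ' := κ₁ ⊕ κ₂) Sum.inl)) 0 0
        ((D₂⁻¹.map Subtype.val).map (incl (κ' := κ₁ ⊕ κ₂) Sum.inr)) := by
    ext (i | i) (j | j) : 2 <;> rfl
  -- The product `B D⁻¹ C` is formed over the full, noncommutative Grassmann algebra; only
  -- afterwards are its entries projected to the even part.
  have hprod : ∀ {R S T : Type} [Ring R] [Ring S] [Ring T] (f : R →+* T) (g : S →+* T)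
      (B₁ : Matrix ι₁ κ₁ R) (E₁ : Matrix κ₁ κ₁ R) (C₁ : Matrix κ₁ ι₁ R)
      (B₂ : Matrix ι₂ κ₂ S) (E₂ : Matrix κ₂ κ₂ S) (C₂ : Matrix κ₂ ι₂ S),
      Matrix.fromBlocks (B₁.map f) 0 0 (B₂.map g) * Matrix.fromBlocks (E₁.map f) 0 0 (E₂.map g) *
        Matrix.fromBlocks (C₁.map f) 0 0 (C₂.map g) =
      Matrix.fromBlocks ((B₁ * E₁ * C₁).map f) 0 0 ((B₂ * E₂ * C₂).map g) := by
    intros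
    simp [Matrix.fromBlocks_multiply, Matrix.map_mul]
  have hsub : ∀ (A₁ B₁ : Matrix ι₁ ι₁ (evenPart κ₁)) (A₂ B₂ : Matrix ι₂ ι₂ (evenPart κ₂)),
      Matrix.fromBlocks (A₁.map φ) 0 0 (A₂.map ψ) - Matrix.fromBlocks (B₁.map φ) 0 0 (B₂.map ψ) =
        Matrix.fromBlocks ((A₁ - B₁).map φ) 0 0 ((A₂ - B₂).map ψ) := by
    intro A₁ B₁ A₂ B₂
    ext (i | i) (j | j) : 2 <;> simp
  have hP := hprod (incl (κ' := κ₁ ⊕ κ₂) Sum.inl).toRingHom (incl (κ' := κ₁ ⊕ κ₂) Sum.inr).toRingHom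
    J₁.toBlocks₁₂ (D₁⁻¹.map Subtype.val) J₁.toBlocks₂₁
    J₂.toBlocks₁₂ (D₂⁻¹.map Subtype.val) J₂.toBlocks₂₁
  simp only [AlgHom.toRingHom_eq_coe, RingHom.coe_coe] at hP
  have hdet : ∀ {m n : Type} [Fintype m] [DecidableEq m] [Fintype n] [DecidableEq n]
      (A : Matrix m m (evenPart κ₁)) (B : Matrix n n (evenPart κ₂)),
      (Matrix.fromBlocks (A.map φ) 0 0 (B.map ψ)).det = φ A.det * ψ B.det := by
    intros
    rw [Matrix.det_fromBlocks_zero₂₁, RingHom.map_det, RingHom.map_det]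
    rfl
  simp only [berezinian, hb₁₁, hb₁₂, hb₂₁, hb₂₂, hm]
  rw [← hD₁, ← hD₂, inv_fromBlocks_map φ ψ hu₁ hu₂, hinv, hP, hm, hsub, hdet, hdet,
    Ring.mul_inverse_rev, map_inverse_of_isUnit φ hu₁, map_inverse_of_isUnit ψ hu₂]
  change _ = ((φ (_ * _) * ψ (_ * _) : evenPart (κ₁ ⊕ κ₂)) : Grassmann (κ₁ ⊕ κ₂))
  rw [map_mul, map_mul]
  congr 1
  ring

end

/-! ### The product of Berezin volumes -/

section
variable {ι₁ κ₁ ι₂ κ₂ : Type} [Fintype ι₁] [DecidableEq ι₁] [Fintype κ₁] [DecidableEq κ₁]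
  [Fintype ι₂] [DecidableEq ι₂] [Fintype κ₂] [DecidableEq κ₂]

theorem partialD_liftFst {f : (ι₁ → ℝ) → Grassmann κ₁} {x : ι₁ ⊕ ι₂ → ℝ}
    (hf : ContDiffAt ℝ ∞ f (x ∘ Sum.inl)) (a : (ι₁ ⊕ ι₂) ⊕ (κ₁ ⊕ κ₂)) :
    partialD a (liftFst f) x =
      sumIndex (fun a => incl Sum.inl (partialD a f (x ∘ Sum.inl))) (fun _ => 0) a := by
  rcases a with (a | a) | (a | a)
  · exact partialD_lift_inl Sum.inl_injective _ hf a
  · exact partialD_lift_inl_of_notMem _ hf (by simp)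
  · exact partialD_lift_inr _ Sum.inl_injective _ _ a
  · exact partialD_lift_inr_of_notMem _ _ _ (by simp)

theorem partialD_liftSnd {f : (ι₂ → ℝ) → Grassmann κ₂} {x : ι₁ ⊕ ι₂ → ℝ}
    (hf : ContDiffAt ℝ ∞ f (x ∘ Sum.inr)) (a : (ι₁ ⊕ ι₂) ⊕ (κ₁ ⊕ κ₂)) :
    partialD a (liftSnd f) x =
      sumIndex (fun _ => 0) (fun a => incl Sum.inr (partialD a f (x ∘ Sum.inr))) a := by
  rcases a with (a | a) | (a | a)
  · exact partialD_lift_inl_of_notMem _ hf (by simp)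
  · exact partialD_lift_inl Sum.inr_injective _ hf a
  · exact partialD_lift_inr_of_notMem _ _ _ (by simp)
  · exact partialD_lift_inr _ Sum.inr_injective _ _ a

namespace Supermanifold

variable {M₁ : Supermanifold ι₁ κ₁} {M₂ : Supermanifold ι₂ κ₂}

/-- The new coordinates of one factor do not depend on the old coordinates of the other. -/
theorem jacobian_prod {i j : (M₁.prod M₂).index} {x : ι₁ ⊕ ι₂ → ℝ}
    (hx : x ∈ (M₁.prod M₂).overlap i j) :
    (M₁.prod M₂).jacobian i j x = blockSum (M₁.jacobian i.1 j.1 (x ∘ Sum.inl))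
      (M₂.jacobian i.2 j.2 (x ∘ Sum.inr)) := by
  obtain ⟨h1, h2⟩ := mem_prod_overlap.mp hx
  ext a b
  rcases b with (b | b) | (b | b)
  · exact partialD_liftFst (M₁.contDiffAt_trans h1 (Sum.inl b)) a
  · exact partialD_liftSnd (M₂.contDiffAt_trans h2 (Sum.inl b)) a
  · exact partialD_liftFst (M₁.contDiffAt_trans h1 (Sum.inr b)) a
  · exact partialD_liftSnd (M₂.contDiffAt_trans h2 (Sum.inr b)) a

/-- The product of two Berezin volumes. -/
def BerezinVolume.prod (ρ₁ : M₁.BerezinVolume) (ρ₂ : M₂.BerezinVolume) :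
    (M₁.prod M₂).BerezinVolume where
  density := fun i x => liftFst (ρ₁.density i.1) x * liftSnd (ρ₂.density i.2) x
  smooth_density := fun i x hx => ContDiffAt.contDiffWithinAt <| contDiffAt_mul
    (contDiffAt_lift _ _ (ρ₁.contDiffAt_density (mem_prod_target.mp hx).1))
    (contDiffAt_lift _ _ (ρ₂.contDiffAt_density (mem_prod_target.mp hx).2))
  even_density := fun i x hx => mul_mem_even
    (incl_mem _ (ρ₁.even_density _ _ (mem_prod_target.mp hx).1))
    (incl_mem _ (ρ₂.even_density _ _ (mem_prod_target.mp hx).2))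
  isUnit_density := fun i x hx =>
    ((ρ₁.isUnit_density _ _ (mem_prod_target.mp hx).1).map (incl Sum.inl)).mul
      ((ρ₂.isUnit_density _ _ (mem_prod_target.mp hx).2).map (incl Sum.inr))
  density_trans := fun i j x hx => by
    obtain ⟨h1, h2⟩ := mem_prod_overlap.mp hx
    have hz := base_mem_target hx
    have hs₁ : ContDiffOn ℝ ∞ (liftFst (ι₂ := ι₂) (κ₂ := κ₂) (ρ₁.density j.1))
        ((M₁.prod M₂).chart j).target := fun y hy => ContDiffAt.contDiffWithinAt <|
      contDiffAt_lift _ _ (ρ₁.contDiffAt_density (mem_prod_target.mp hy).1)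
    have hs₂ : ContDiffOn ℝ ∞ (liftSnd (ι₁ := ι₁) (κ₁ := κ₁) (ρ₂.density j.2))
        ((M₁.prod M₂).chart j).target := fun y hy => ContDiffAt.contDiffWithinAt <|
      contDiffAt_lift _ _ (ρ₂.contDiffAt_density (mem_prod_target.mp hy).2)
    have e₁ : subst (liftFst (ρ₁.density j.1)) ((M₁.prod M₂).trans i j x) = _ :=
      subst_liftFst (M₁.trans i.1 j.1 (x ∘ Sum.inl)) (M₂.trans i.2 j.2 (x ∘ Sum.inr))
        (ρ₁.contDiffAt_density (base_mem_target h1))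
    have e₂ : subst (liftSnd (ρ₂.density j.2)) ((M₁.prod M₂).trans i j x) = _ :=
      subst_liftSnd (M₁.trans i.1 j.1 (x ∘ Sum.inl)) (M₂.trans i.2 j.2 (x ∘ Sum.inr))
        (ρ₂.contDiffAt_density (base_mem_target h2))
    rw [subst_mul ((M₁.prod M₂).chart j).open_target hz hs₁ hs₂, e₁, e₂, jacobian_prod hx,
      berezinian_blockSum (isUnit_of_body_ne_zero (ρ₁.body_berezinian_ne_zero h1))
        (isUnit_of_body_ne_zero (ρ₂.body_berezinian_ne_zero h2))]
    change incl Sum.inl (ρ₁.density i.1 _) * incl Sum.inr (ρ₂.density i.2 _) = _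
    rw [ρ₁.density_trans _ _ _ h1, ρ₂.density_trans _ _ _ h2, map_mul, map_mul]
    -- The second Berezinian is even, so it can be moved past the first density to stand next to the
    -- first Berezinian.
    have hc := even_mul_comm (incl_mem (κ' := κ₁ ⊕ κ₂) Sum.inr
      (x := berezinian (M₂.jacobian i.2 j.2 (x ∘ Sum.inr))) (p := 0) (Subtype.prop _))
      (incl Sum.inl (subst (ρ₁.density j.1) (M₁.trans i.1 j.1 (x ∘ Sum.inl))))
    rw [mul_assoc, mul_assoc, ← mul_assoc (incl Sum.inr _), hc, mul_assoc]

/-! ### The divergence and the modular class of a product. -/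

theorem VectorField.coordDiv_prod {p : ZMod 2} (X₁ : M₁.VectorField p) (X₂ : M₂.VectorField p)
    {i : (M₁.prod M₂).index} {x : ι₁ ⊕ ι₂ → ℝ} (hx : x ∈ ((M₁.prod M₂).chart i).target) :
    (X₁.prod X₂).coordDiv i x = incl Sum.inl (X₁.coordDiv i.1 (x ∘ Sum.inl)) +
      incl Sum.inr (X₂.coordDiv i.2 (x ∘ Sum.inr)) := by
  obtain ⟨h1, h2⟩ := mem_prod_target.mp hx
  have e : ∀ a, partialD a ((X₁.prod X₂).comp i a) x = sumIndex
      (fun a => incl Sum.inl (partialD a (X₁.comp i.1 a) (x ∘ Sum.inl)))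
      (fun a => incl Sum.inr (partialD a (X₂.comp i.2 a) (x ∘ Sum.inr))) a := by
    rintro ((a | a) | (a | a))
    · exact partialD_liftFst (X₁.contDiffAt_comp h1 (Sum.inl a)) _
    · exact partialD_liftSnd (X₂.contDiffAt_comp h2 (Sum.inl a)) _
    · exact partialD_liftFst (X₁.contDiffAt_comp h1 (Sum.inr a)) _
    · exact partialD_liftSnd (X₂.contDiffAt_comp h2 (Sum.inr a)) _
  simp only [coordDiv, e, map_sum, map_add, Fintype.sum_sum_type, sumIndex, Sum.elim_inl, Sum.elim_inr]
  abel

/-- On `ρ₁ρ₂` the Leibniz rule leaves `X₁` acting on `ρ₁` and `X₂` acting on `ρ₂`, and the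
coordinate divergences add. The two given equations, each multiplied by the other density, then sum
to the required one. -/
theorem VectorField.IsDivergence.prod {X₁ : M₁.VectorField 1} {X₂ : M₂.VectorField 1}
    {ρ₁ : M₁.BerezinVolume} {ρ₂ : M₂.BerezinVolume} {d₁ : M₁.index → (ι₁ → ℝ) → Grassmann κ₁}
    {d₂ : M₂.index → (ι₂ → ℝ) → Grassmann κ₂} (hd₁ : X₁.IsDivergence ρ₁ d₁)
    (hd₂ : X₂.IsDivergence ρ₂ d₂) :
    (X₁.prod X₂).IsDivergence (ρ₁.prod ρ₂) (pullFst M₁ M₂ d₁ + pullSnd M₁ M₂ d₂) := by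
  refine ⟨add_mem (pullFst_mem M₁ M₂ hd₁.1) (pullSnd_mem M₁ M₂ hd₂.1), fun i x hx => ?_⟩
  obtain ⟨hx₁, hx₂⟩ := mem_prod_target.mp hx
  have hρ₁ := ρ₁.contDiffAt_density hx₁
  have hρ₂ := ρ₂.contDiffAt_density hx₂
  have hl₁ : DifferentiableAt ℝ (liftFst (ι₂ := ι₂) (κ₂ := κ₂) (ρ₁.density i.1)) x :=
    (contDiffAt_lift _ _ hρ₁).differentiableAt (by simp)
  have hl₂ : DifferentiableAt ℝ (liftSnd (ι₁ := ι₁) (κ₁ := κ₁) (ρ₂.density i.2)) x :=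
    (contDiffAt_lift _ _ hρ₂).differentiableAt (by simp)
  have he₁ := incl_mem (κ' := κ₁ ⊕ κ₂) Sum.inl (ρ₁.even_density _ _ hx₁)
  have he₂ := incl_mem (κ' := κ₁ ⊕ κ₂) Sum.inr (ρ₂.even_density _ _ hx₂)
  have e₁ := hd₁.2 _ _ hx₁
  have e₂ := hd₂.2 _ _ hx₂
  rw [X₁.lieDeriv_eq hx₁ (hρ₁.differentiableAt (by simp))] at e₁
  rw [X₂.lieDeriv_eq hx₂ (hρ₂.differentiableAt (by simp))] at e₂
  replace e₁ := congrArg (incl (κ' := κ₁ ⊕ κ₂) Sum.inl) e₁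
  replace e₂ := congrArg (incl (κ' := κ₁ ⊕ κ₂) Sum.inr) e₂
  simp only [map_mul, map_add] at e₁ e₂
  rw [VectorField.lieDeriv_eq _ hx (((ρ₁.prod ρ₂).contDiffAt_density hx).differentiableAt (by simp)),
    VectorField.coordDiv_prod X₁ X₂ hx]
  have hact : (X₁.prod X₂).act i ((ρ₁.prod ρ₂).density i) x = _ :=
    (X₁.prod X₂).act_mul i hl₁ hl₂ he₁
  rw [hact, VectorField.act_prod_liftFst _ _ _ hρ₁, VectorField.act_prod_liftSnd _ _ _ hρ₂]
  have hv : (pullFst M₁ M₂ d₁ + pullSnd M₁ M₂ d₂) i x =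
      incl Sum.inl (d₁ i.1 (x ∘ Sum.inl)) + incl Sum.inr (d₂ i.2 (x ∘ Sum.inr)) :=
    congrArg₂ (· + ·) (pullFst_eventuallyEq M₁ M₂ d₁ hx).eq_of_nhds
      (pullSnd_eventuallyEq M₁ M₂ d₂ hx).eq_of_nhds
  rw [hv]
  change incl Sum.inl (ρ₁.density i.1 _) * incl Sum.inr (ρ₂.density i.2 _) * _ =
    _ * (incl Sum.inl (ρ₁.density i.1 _) * incl Sum.inr (ρ₂.density i.2 _)) +
      (incl Sum.inl (X₁.act i.1 (ρ₁.density i.1) _) * incl Sum.inr (ρ₂.density i.2 _) +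
        incl Sum.inl (ρ₁.density i.1 _) * incl Sum.inr (X₂.act i.2 (ρ₂.density i.2) _))
  -- Here `r`, `D`, `l`, `q` stand for density, divergence, coordinate divergence and the field
  -- applied to the density. Only the densities have to commute with the rest.
  have key : ∀ {r₁ r₂ D₁ D₂ l₁ l₂ q₁ q₂ : Grassmann (κ₁ ⊕ κ₂)}, r₁ ∈ parityPart _ 0 →
      r₂ ∈ parityPart _ 0 → r₁ * D₁ = l₁ * r₁ + q₁ → r₂ * D₂ = l₂ * r₂ + q₂ →
      r₁ * r₂ * (D₁ + D₂) = (l₁ + l₂) * (r₁ * r₂) + (q₁ * r₂ + r₁ * q₂) := by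
    intro r₁ r₂ D₁ D₂ l₁ l₂ q₁ q₂ h₁ h₂ h₃ h₄
    calc r₁ * r₂ * (D₁ + D₂) = r₁ * D₁ * r₂ + r₁ * (r₂ * D₂) := by
          rw [mul_add, mul_assoc, even_mul_comm h₂ D₁, ← mul_assoc, mul_assoc r₁ r₂]
      _ = l₁ * (r₁ * r₂) + q₁ * r₂ + (r₁ * l₂ * r₂ + r₁ * q₂) := by
          rw [h₃, h₄, add_mul, mul_add, mul_assoc, mul_assoc]
      _ = _ := by
          rw [even_mul_comm h₁ l₂, add_mul, mul_assoc l₂]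
          abel
  exact key he₁ he₂ e₁ e₂

end Supermanifold

theorem QManifold.IsModularClass.prod {M₁ : QManifold ι₁ κ₁} {M₂ : QManifold ι₂ κ₂}
    {c₁ : M₁.Cohomology} {c₂ : M₂.Cohomology} (h₁ : M₁.IsModularClass c₁)
    (h₂ : M₂.IsModularClass c₂) :
    (M₁.prod M₂).IsModularClass (M₁.cohomologyFst M₂ c₁ + M₁.cohomologySnd M₂ c₂) := by
  obtain ⟨ρ₁, d₁, hd₁, rfl⟩ := h₁
  obtain ⟨ρ₂, d₂, hd₂, rfl⟩ := h₂
  exact ⟨ρ₁.prod ρ₂, M₁.pullFstCocycles M₂ d₁ + M₁.pullSndCocycles M₂ d₂, hd₁.prod hd₂, rfl⟩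

end

end Super

end

/-- The backward implication contains the existence of a modular class of the product together with
the formula; the forward one is its uniqueness. -/
theorem mainTheorem4 {ι₁ κ₁ ι₂ κ₂ : Type} [Fintype ι₁] [DecidableEq ι₁] [Fintype κ₁]
    [DecidableEq κ₁] [Fintype ι₂] [DecidableEq ι₂] [Fintype κ₂] [DecidableEq κ₂]
    (M₁ : Super.QManifold ι₁ κ₁) (M₂ : Super.QManifold ι₂ κ₂)
    (c₁ : M₁.Cohomology) (c₂ : M₂.Cohomology)
    (h₁ : M₁.IsModularClass c₁) (h₂ : M₂.IsModularClass c₂)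
    (c₁₂ : (M₁.prod M₂).Cohomology) :
    (M₁.prod M₂).IsModularClass c₁₂ ↔
      c₁₂ = M₁.cohomologyFst M₂ c₁ + M₁.cohomologySnd M₂ c₂ :=
  ⟨fun h => h.unique (h₁.prod h₂), fun h => h ▸ h₁.prod h₂⟩
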